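/- Let $N,L$ be nonnegative integers, let $\alpha=[\alpha_0,\alpha_1,\dots,\alpha_N]$ be real with $\alpha_0=0$, and let $R(z)=\sum_{k=0}^{N}\alpha_k z^{-k}$. Let $A\in\mathbb{R}^{N\times N}$ be the matrix with ones on the first superdiagonal and zeros elsewhere, $B=[0,\dots,0,1]^\top\in\mathbb{R}^{N\times 1}$ and $C(\alpha)=[\alpha_N,\alpha_{N-1},\dots,\alpha_1]\in\mathbb{R}^{1\times N}$. For $l=1,\dots,L$ let $\omega_l\in(0,\pi)$, $\Omega_l>0$ and $\gamma_l>0$ be such that $I_l:=[\omega_l-\Omega_l,\omega_l+\Omega_l]\subset[0,\pi]$. For real symmetric $N\times N$ matrices $X,Y$ and real $\omega_0,\Omega,\gamma$ put \[ \begin{aligned} M_4(X,Y,\omega_0,\Omega)&=A^\top XA+YA\,e^{-\mathrm{j}\omega_0}+A^\top Y\,e^{\mathrm{j}\omega_0}-X-2Y\cos\Omega,\\ M_5(X,Y,\omega_0)&=A^\top XB+YB\,e^{-\mathrm{j}\omega_0},\\ \overline{M}_5(X,Y,\omega_0)&=A^\top XB+YB\,e^{\mathrm{j}\omega_0},\\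 M_6(X,\gamma^2)&=B^\top XB-\gamma^2. \end{aligned} \] Then the inequalities \[ \max_{\omega\in I_l}\left|1+R(e^{\mathrm{j}\omega})\right|<\gamma_l,\qquad l=1,\dots,L, \] all hold if and only if there exist real symmetric $N\times N$ matrices $X_l$ and $Y_l$ with $Y_l$ positive definite, $l=1,\dots,L$, such that for every $l=1,\dots,L$ the (complex Hermitian) matrix \[ \begin{bmatrix} M_4(X_l,Y_l,\omega_l,\Omega_l) & M_5(X_l,Y_l,\omega_l) & C(\alpha)^\top\\ \overline{M}_5(X_l,Y_l,\omega_l)^\top & M_6(X_l,\gamma_l^2) & 1\\ C(\alpha) & 1 & -1 \end{bmatrix} \] is negative definite. -/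

import Mathlib

open scoped ComplexOrder Matrix

namespace MultiBand

/-- The FIR filter `R(z) = ∑_{k=0}^N α_k z^{-k}` with real coefficients. -/
noncomputable def fir {N : ℕ} (α : Fin (N + 1) → ℝ) (z : ℂ) : ℂ :=
  ∑ k : Fin (N + 1), (α k : ℂ) * z ^ (-((k : ℕ) : ℤ))

/-- The noise transfer function `1 + R(z)`. -/
noncomputable def ntf {N : ℕ} (α : Fin (N + 1) → ℝ) (z : ℂ) : ℂ :=
  1 + fir α z

/-- The magnitude `|1 + R(e^{jω})|` of the frequency response. -/
noncomputable def gain {N : ℕ} (α : Fin (N + 1) → ℝ) (ω : ℝ) : ℝ :=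
  ‖ntf α (Complex.exp (ω * Complex.I))‖

/-- The worst-case gain over a band: the maximum of the gain over `I`
(attained on a nonempty compact band, see `worstGain_isGreatest`). -/
noncomputable def worstGain {N : ℕ} (α : Fin (N + 1) → ℝ) (I : Set ℝ) : ℝ :=
  sSup (gain α '' I)

theorem gain_continuous {N : ℕ} (α : Fin (N + 1) → ℝ) : Continuous (gain α) := by
  unfold gain ntf fir
  refine continuous_norm.comp (continuous_const.add (continuous_finsetSum _ fun k _ => ?_))
  refine continuous_const.mul (Continuous.zpow₀ (by fun_prop) _ fun ω => ?_)
  exact Or.inl (Complex.exp_ne_zero _)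

/-- The supremum in `worstGain` is a maximum. -/
theorem worstGain_isGreatest {N : ℕ} (α : Fin (N + 1) → ℝ) {I : Set ℝ}
    (hI : IsCompact I) (hne : I.Nonempty) :
    IsGreatest (gain α '' I) (worstGain α I) :=
  (hI.image (gain_continuous α)).isGreatest_sSup (hne.image _)

/-- The shift matrix: ones on the superdiagonal, zeros elsewhere. -/
def A (N : ℕ) : Matrix (Fin N) (Fin N) ℝ :=
  Matrix.of fun i j => if (j : ℕ) = (i : ℕ) + 1 then 1 else 0

/-- The column `[0, …, 0, 1]ᵀ`. -/
def B (N : ℕ) : Matrix (Fin N) (Fin 1) ℝ :=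
  Matrix.of fun i _ => if (i : ℕ) + 1 = N then 1 else 0

/-- The row `[α_N, α_{N-1}, …, α_1]`. -/
def C {N : ℕ} (α : Fin (N + 1) → ℝ) : Matrix (Fin 1) (Fin N) ℝ :=
  Matrix.of fun _ i => α i.rev.succ

/-- A real matrix viewed as a complex one. -/
noncomputable def toC {m n : Type*} (M : Matrix m n ℝ) : Matrix m n ℂ :=
  M.map ((↑) : ℝ → ℂ)

/-- `AᵀXA + YA e^{-jω₀} + AᵀY e^{jω₀} - X - 2Y cos Ω`. -/
noncomputable def M4 {N : ℕ} (X Y : Matrix (Fin N) (Fin N) ℝ) (ω₀ Ω : ℝ) :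
    Matrix (Fin N) (Fin N) ℂ :=
  toC ((A N)ᵀ * X * A N)
    + Complex.exp (-(ω₀ * Complex.I)) • toC (Y * A N)
    + Complex.exp (ω₀ * Complex.I) • toC ((A N)ᵀ * Y)
    - toC X - ((2 * Real.cos Ω : ℝ) : ℂ) • toC Y

/-- `AᵀXB + YB e^{-jω₀}`. -/
noncomputable def M5 {N : ℕ} (X Y : Matrix (Fin N) (Fin N) ℝ) (ω₀ : ℝ) :
    Matrix (Fin N) (Fin 1) ℂ :=
  toC ((A N)ᵀ * X * B N) + Complex.exp (-(ω₀ * Complex.I)) • toC (Y * B N)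

/-- `AᵀXB + YB e^{jω₀}`. -/
noncomputable def M5bar {N : ℕ} (X Y : Matrix (Fin N) (Fin N) ℝ) (ω₀ : ℝ) :
    Matrix (Fin N) (Fin 1) ℂ :=
  toC ((A N)ᵀ * X * B N) + Complex.exp (ω₀ * Complex.I) • toC (Y * B N)

/-- `BᵀXB - g`, where `g` stands for `γ²`. -/
noncomputable def M6 {N : ℕ} (X : Matrix (Fin N) (Fin N) ℝ) (g : ℝ) :
    Matrix (Fin 1) (Fin 1) ℂ :=
  toC ((B N)ᵀ * X * B N) - (g : ℂ) • (1 : Matrix (Fin 1) (Fin 1) ℂ)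

/-- The bandpass block matrix
`[[M4, M5, Cᵀ], [M5barᵀ, M6, 1], [C, 1, -1]]`. -/
noncomputable def lmi {N : ℕ} (α : Fin (N + 1) → ℝ) (X Y : Matrix (Fin N) (Fin N) ℝ)
    (ω₀ Ω γ : ℝ) : Matrix ((Fin N ⊕ Fin 1) ⊕ Fin 1) ((Fin N ⊕ Fin 1) ⊕ Fin 1) ℂ :=
  Matrix.fromBlocks
    (Matrix.fromBlocks (M4 X Y ω₀ Ω) (M5 X Y ω₀) (M5bar X Y ω₀)ᵀ (M6 X (γ ^ 2)))
    (Matrix.fromRows (toC (C α)ᵀ) 1)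
    (Matrix.fromCols (toC (C α)) 1)
    (-1)

/-- `F < 0`: the complex matrix `F` is Hermitian and negative definite. -/
def NegDef {n : Type*} (F : Matrix n n ℂ) : Prop :=
  (-F).PosDef

end MultiBand

/-! The bands do not interact, so the argument concerns one band. Completing the square in the last
variable (a Schur complement) turns the matrix inequality into: the Gram matrix of `γ² - |1 + R|²`
minus the band form of `X, Y` is positive definite (`negDef_lmi_iff`).

On the geometric vector `(1, z, …, z^N)`, `z = e^{jθ}`, the terms in `X` cancel and those in `Y`
give `2 (cos (θ - ω) - cos Ω) u*Yu`, which is nonnegative on the band (`bandForm_geom_re_nonneg`).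
Hence the matrix inequality bounds the gain.

Conversely, `γ² - |1 + R|²` is a polynomial of degree at most `N` in `cos θ`, positive on `[cos (ω +
Ω), cos (ω - Ω)]`. The Markov–Lukács theorem (`mem_intervalCone_of_nonneg`) decomposes a nonnegative
one into generators, each of which has an explicit certificate (`bandCert_of_mem_intervalCone`).
This certifies some Gram matrix of the polynomial. Two Gram matrices of one polynomial differ by a
shift difference, which is absorbed in `X` (`exists_shift_eq`). A multiple of the identity, set
aside beforehand by compactness, pays for strictness and for a definite `Y` (`exists_bandForm_lt`).
-/

/-! ### Nonnegative polynomials on an interval. -/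

namespace IntervalPositivity

open Polynomial

/-- The cone of real polynomials generated by `(X - a)^e (b - X)^f r²` of formal degree at most
`N`. -/
noncomputable def intervalCone (a b : ℝ) (N : ℕ) : AddSubmonoid ℝ[X] :=
  AddSubmonoid.closure {p | ∃ (m e f : ℕ) (r : ℝ[X]), r.natDegree ≤ m ∧ 2 * m + e + f ≤ N ∧
    p = (X - C a) ^ e * (C b - X) ^ f * r ^ 2}

theorem generator_mem_intervalCone (a b : ℝ) {N : ℕ} (m e f : ℕ) (r : ℝ[X])
    (hr : r.natDegree ≤ m) (h : 2 * m + e + f ≤ N) :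
    (X - C a) ^ e * (C b - X) ^ f * r ^ 2 ∈ intervalCone a b N :=
  AddSubmonoid.subset_closure ⟨m, e, f, r, hr, h, rfl⟩

theorem mul_mem_intervalCone {a b : ℝ} {M N : ℕ} {p q : ℝ[X]} (hp : p ∈ intervalCone a b M)
    (hq : q ∈ intervalCone a b N) : p * q ∈ intervalCone a b (M + N) := by
  unfold intervalCone at hp
  induction hp using AddSubmonoid.closure_induction with
  | zero => simp
  | add x y _ _ hx hy => rw [add_mul]; exact add_mem hx hy
  | mem x hx =>
    obtain ⟨m, e, f, r, hr, h, rfl⟩ := hx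
    unfold intervalCone at hq
    induction hq using AddSubmonoid.closure_induction with
    | zero => simp
    | add x y _ _ hx hy => rw [mul_add]; exact add_mem hx hy
    | mem y hy =>
      obtain ⟨m', e', f', r', hr', h', rfl⟩ := hy
      have := generator_mem_intervalCone a b (N := M + N) (m + m') (e + e') (f + f') (r * r')
        (natDegree_mul_le.trans (add_le_add hr hr')) (by omega)
      convert this using 1
      ring

theorem C_mem_intervalCone {a b c : ℝ} (hc : 0 ≤ c) (N : ℕ) : C c ∈ intervalCone a b N := by
  have := generator_mem_intervalCone a b (N := N) 0 0 0 (C (√c)) (by simp) (by simp)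
  rwa [pow_zero, pow_zero, one_mul, one_mul, ← C_pow, Real.sq_sqrt hc] at this

theorem X_sub_C_mem_intervalCone {a b ρ : ℝ} (h : ρ ≤ a) : X - C ρ ∈ intervalCone a b 1 := by
  have h1 := generator_mem_intervalCone a b (N := 1) 0 1 0 1 (by simp) (by simp)
  have h2 := add_mem h1 (C_mem_intervalCone (a := a) (b := b) (sub_nonneg.2 h) 1)
  convert h2 using 1
  simp only [C_sub]; ring

theorem C_sub_X_mem_intervalCone {a b ρ : ℝ} (h : b ≤ ρ) : C ρ - X ∈ intervalCone a b 1 := by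
  have h1 := generator_mem_intervalCone a b (N := 1) 0 0 1 1 (by simp) (by simp)
  have h2 := add_mem h1 (C_mem_intervalCone (a := a) (b := b) (sub_nonneg.2 h) 1)
  convert h2 using 1
  simp only [C_sub]; ring

theorem sq_mem_intervalCone (a b ρ : ℝ) : (X - C ρ) ^ 2 ∈ intervalCone a b 2 := by
  have h1 := generator_mem_intervalCone a b (N := 2) 1 0 0 (X - C ρ) (by simp) (by simp)
  simpa using h1

/-- A polynomial function which is nonnegative on `[a, b]` except possibly at one point is
nonnegative on all of `[a, b]`. -/
theorem eval_nonneg_of_ne {a b ρ : ℝ} (hab : a < b) {q : ℝ[X]}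
    (h : ∀ x ∈ Set.Icc a b, x ≠ ρ → 0 ≤ q.eval x) : ∀ x ∈ Set.Icc a b, 0 ≤ q.eval x := by
  intro x hx
  by_contra! hneg
  have hev : ∀ᶠ y in nhds x, q.eval y < 0 :=
    q.continuous.continuousAt.eventually_lt continuousAt_const hneg
  have hxρ : x = ρ := by
    by_contra hne
    exact absurd (h x hx hne) (not_le.2 hneg)
  subst hxρ
  rcases hx.2.lt_or_eq with hlt | heq
  · obtain ⟨y, hy, hy'⟩ :=
      ((hev.filter_mono nhdsWithin_le_nhds).and (Ioo_mem_nhdsGT hlt)).exists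
    exact absurd (h y ⟨hx.1.trans hy'.1.le, hy'.2.le⟩ hy'.1.ne') (not_le.2 hy)
  · have hlt : a < x := heq ▸ hab
    obtain ⟨y, hy, hy'⟩ :=
      ((hev.filter_mono nhdsWithin_le_nhds).and (Ioo_mem_nhdsLT hlt)).exists
    exact absurd (h y ⟨hy'.1.le, hy'.2.le.trans hx.2⟩ hy'.2.ne) (not_le.2 hy)

/-- The quadratic is `(X - Re z)² + (Im z)²`. -/
theorem quadratic_mem_intervalCone (a b : ℝ) (z : ℂ) :
    X ^ 2 - C (2 * z.re) * X + C (‖z‖ ^ 2) ∈ intervalCone a b 2 := by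
  have h := add_mem (sq_mem_intervalCone a b z.re)
    (C_mem_intervalCone (a := a) (b := b) (sq_nonneg z.im) 2)
  convert h using 1
  rw [Complex.sq_norm, Complex.normSq_apply]
  simp only [C_add, C_mul, C_pow]
  have : (C 2 : ℝ[X]) = 2 := rfl
  rw [this]
  ring

theorem quadratic_eval_pos {z : ℂ} (hz : z.im ≠ 0) (x : ℝ) :
    0 < (X ^ 2 - C (2 * z.re) * X + C (‖z‖ ^ 2) : ℝ[X]).eval x := by
  rw [Complex.sq_norm, Complex.normSq_apply]
  simp only [eval_add, eval_sub, eval_pow, eval_X, eval_mul, eval_C]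
  nlinarith [sq_nonneg (x - z.re), mul_self_pos.2 hz]

/-- **Markov–Lukács**: a real polynomial of degree at most `N` which is nonnegative on `[a, b]`
lies in the cone generated by `(X - a)^e (b - X)^f r²` of formal degree at most `N`. -/
theorem mem_intervalCone_of_nonneg {a b : ℝ} (hab : a < b) (N : ℕ) :
    ∀ p : ℝ[X], p.natDegree ≤ N → (∀ x ∈ Set.Icc a b, 0 ≤ p.eval x) →
      p ∈ intervalCone a b N := by
  induction N using Nat.strong_induction_on with
  | _ N ih =>
  intro p hdeg hp
  rcases Nat.eq_zero_or_pos p.natDegree with h0 | hpos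
  · rw [eq_C_of_natDegree_eq_zero h0]
    apply C_mem_intervalCone
    have := hp a ⟨le_rfl, hab.le⟩
    rwa [eq_C_of_natDegree_eq_zero h0, eval_C] at this
  -- Induction step: split off a factor in the cone of its own degree and apply the hypothesis to
  -- the cofactor. The cases below supply a linear factor for a root outside `(a, b)`, a squared one
  -- for a root inside, or a quadratic for a conjugate pair.
  have key : ∀ (g q : ℝ[X]) (k : ℕ), p = g * q → g.natDegree = k → 0 < k →
      g ∈ intervalCone a b k → (∀ x ∈ Set.Icc a b, 0 ≤ q.eval x) → p ∈ intervalCone a b N := by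
    intro g q k hpq hg hk hgc hq
    have hp0 : p ≠ 0 := by rintro rfl; simp at hpos
    have hg0 : g ≠ 0 := by rintro rfl; simp at hpq; exact hp0 hpq
    have hq0 : q ≠ 0 := by rintro rfl; simp at hpq; exact hp0 hpq
    have hd : p.natDegree = k + q.natDegree := by rw [hpq, natDegree_mul hg0 hq0, hg]
    have := mul_mem_intervalCone hgc (ih (N - k) (by omega) q (by omega) hq)
    rw [hpq]
    convert this using 2
    omega
  by_cases hroot : ∃ ρ, p.IsRoot ρ
  · obtain ⟨ρ, hρ⟩ := hroot
    obtain ⟨q, hq⟩ := dvd_iff_isRoot.2 hρ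
    rcases le_or_gt ρ a with hρa | hρa
    · refine key _ q 1 hq (natDegree_X_sub_C _) one_pos (X_sub_C_mem_intervalCone hρa) ?_
      -- Dividing by the factor fixes the sign of the cofactor only off `ρ`; continuity gives it at
      -- `ρ`.
      refine eval_nonneg_of_ne (ρ := ρ) hab fun x hx hne => ?_
      have h1 := hp x hx
      rw [hq] at h1
      simp only [eval_mul, eval_sub, eval_X, eval_C] at h1
      have h2 : 0 < x - ρ := sub_pos.2 (lt_of_le_of_ne (hρa.trans hx.1) hne.symm)
      exact nonneg_of_mul_nonneg_right h1 h2
    rcases le_or_gt b ρ with hρb | hρb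
    · refine key (C ρ - X) (-q) 1 (by rw [hq]; ring) ?_ one_pos
        (C_sub_X_mem_intervalCone hρb) ?_
      · rw [← neg_sub, natDegree_neg, natDegree_X_sub_C]
      refine eval_nonneg_of_ne (ρ := ρ) hab fun x hx hne => ?_
      have h1 := hp x hx
      rw [hq] at h1
      simp only [eval_mul, eval_sub, eval_X, eval_C, eval_neg] at h1 ⊢
      have h2 : 0 < ρ - x := sub_pos.2 (lt_of_le_of_ne (hx.2.trans hρb) hne)
      nlinarith
    -- An interior root is double: `q` is nonnegative to the right of `ρ` and nonpositive to the
    -- left, so it vanishes at `ρ`.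
    · have hqρ : q.IsRoot ρ := by
        have hl := eval_nonneg_of_ne (ρ := ρ) hρb (q := q) fun x hx hne => by
          have h1 := hp x ⟨hρa.le.trans hx.1, hx.2⟩
          rw [hq] at h1
          simp only [eval_mul, eval_sub, eval_X, eval_C] at h1
          exact nonneg_of_mul_nonneg_right h1 (sub_pos.2 (lt_of_le_of_ne hx.1 hne.symm))
        have hr := eval_nonneg_of_ne (ρ := ρ) hρa (q := -q) fun x hx hne => by
          have h1 := hp x ⟨hx.1, hx.2.trans hρb.le⟩
          rw [hq] at h1
          simp only [eval_mul, eval_sub, eval_X, eval_C, eval_neg] at h1 ⊢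
          have h2 : 0 < ρ - x := sub_pos.2 (lt_of_le_of_ne hx.2 hne)
          nlinarith
        have h1 := hl ρ ⟨le_rfl, hρb.le⟩
        have h2 := hr ρ ⟨hρa.le, le_rfl⟩
        rw [eval_neg] at h2
        exact le_antisymm (by linarith) h1
      obtain ⟨s, hs⟩ := dvd_iff_isRoot.2 hqρ
      have hps : p = (X - C ρ) ^ 2 * s := by rw [hq, hs]; ring
      refine key _ s 2 hps (by rw [natDegree_pow, natDegree_X_sub_C]) two_pos
        (sq_mem_intervalCone a b ρ) ?_
      refine eval_nonneg_of_ne (ρ := ρ) hab fun x hx hne => ?_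
      have h1 := hp x hx
      rw [hps] at h1
      simp only [eval_mul, eval_sub, eval_X, eval_C, eval_pow] at h1
      exact nonneg_of_mul_nonneg_right h1 (sq_pos_of_ne_zero (sub_ne_zero.2 hne))
  · obtain ⟨z, hz⟩ := Complex.exists_root (f := p.map (algebraMap ℝ ℂ))
      (by rw [degree_map]; exact natDegree_pos_iff_degree_pos.1 hpos)
    have hz' : aeval z p = 0 := by
      rwa [IsRoot, eval_map_algebraMap] at hz
    have him : z.im ≠ 0 := by
      intro him
      refine hroot ⟨z.re, ?_⟩
      have hzr : z = algebraMap ℝ ℂ z.re := Complex.ext (by simp) (by simp [him])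
      rw [hzr, aeval_algebraMap_apply] at hz'
      simpa using hz'
    obtain ⟨q, hq⟩ := p.quadratic_dvd_of_aeval_eq_zero_im_ne_zero hz' him
    refine key _ q 2 hq (by compute_degree!) two_pos (quadratic_mem_intervalCone a b z) ?_
    intro x hx
    have h1 := hp x hx
    rw [hq, eval_mul] at h1
    exact nonneg_of_mul_nonneg_right h1 (quadratic_eval_pos him x)

end IntervalPositivity

/-! ### Hermitian forms, band certificates and their multiplication by squares. -/

namespace BandLMI

open Polynomial
open MultiBand (toC)

/-- The sesquilinear form of a real matrix. -/
noncomputable def sform {n : Type*} [Fintype n] (M : Matrix n n ℝ) (x y : n → ℂ) : ℂ :=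
  star x ⬝ᵥ (toC M *ᵥ y)

section sform

variable {m n : Type*}

theorem toC_add (M M' : Matrix m n ℝ) : toC (M + M') = toC M + toC M' := by
  ext; simp [toC]

theorem toC_smul (c : ℝ) (M : Matrix m n ℝ) : toC (c • M) = (c : ℂ) • toC M := by
  ext; simp [toC]

theorem toC_mul {l : Type*} [Fintype m] (M : Matrix l m ℝ) (M' : Matrix m n ℝ) :
    toC (M * M') = toC M * toC M' := by
  ext; simp [toC, Matrix.mul_apply]

theorem toC_transpose (M : Matrix m n ℝ) : toC Mᵀ = (toC M)ᵀ := rfl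

theorem toC_conjTranspose (M : Matrix m n ℝ) : (toC M)ᴴ = toC Mᵀ := by
  ext; simp [toC]

variable [Fintype m] [Fintype n]

theorem sform_eq_sum (M : Matrix n n ℝ) (x y : n → ℂ) :
    sform M x y = ∑ i, ∑ j, (M i j : ℂ) * (star (x i) * y j) := by
  simp only [sform, dotProduct, Matrix.mulVec, Finset.mul_sum, toC, Matrix.map_apply,
    Pi.star_apply]
  exact Finset.sum_congr rfl fun i _ => Finset.sum_congr rfl fun j _ => by ring

@[simp] theorem sform_zero (x y : n → ℂ) : sform (0 : Matrix n n ℝ) x y = 0 := by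
  simp [sform_eq_sum]

theorem sform_add (M M' : Matrix n n ℝ) (x y : n → ℂ) :
    sform (M + M') x y = sform M x y + sform M' x y := by
  simp only [sform, toC_add, Matrix.add_mulVec, dotProduct_add]

theorem sform_smul (c : ℝ) (M : Matrix n n ℝ) (x y : n → ℂ) :
    sform (c • M) x y = c * sform M x y := by
  simp only [sform, toC_smul, Matrix.smul_mulVec, dotProduct_smul, smul_eq_mul]

theorem sform_sub (M M' : Matrix n n ℝ) (x y : n → ℂ) :
    sform (M - M') x y = sform M x y - sform M' x y := by
  rw [sub_eq_add_neg, ← neg_one_smul ℝ M', sform_add, sform_smul]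
  push_cast; ring

theorem sform_smul_vec (M : Matrix n n ℝ) (c : ℂ) (x y : n → ℂ) :
    sform M (c • x) (c • y) = (‖c‖ ^ 2 : ℝ) * sform M x y := by
  have : (‖c‖ ^ 2 : ℝ) = star c * c := by
    rw [Complex.sq_norm, ← Complex.mul_conj, mul_comm]; rfl
  simp only [sform, star_smul, smul_dotProduct, Matrix.mulVec_smul, dotProduct_smul, smul_eq_mul]
  rw [this]; ring

theorem sform_mul_mul_transpose (R : Matrix m n ℝ) (M : Matrix n n ℝ) (x y : m → ℂ) :
    sform (R * M * Rᵀ) x y = sform M ((toC R)ᵀ *ᵥ x) ((toC R)ᵀ *ᵥ y) := by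
  simp only [sform, toC_mul, toC_transpose]
  rw [← Matrix.mulVec_mulVec, ← Matrix.mulVec_mulVec, Matrix.dotProduct_mulVec,
    Matrix.star_mulVec, ← toC_transpose, toC_conjTranspose, Matrix.transpose_transpose]

theorem star_sform (M : Matrix n n ℝ) (hM : M.IsSymm) (x y : n → ℂ) :
    star (sform M x y) = sform M y x := by
  simp only [sform_eq_sum, star_sum, star_mul', star_star]
  rw [Finset.sum_comm]
  refine Finset.sum_congr rfl fun i _ => Finset.sum_congr rfl fun j _ => ?_
  rw [← hM.apply i j]
  simp only [RCLike.star_def, Complex.conj_ofReal]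
  ring

theorem sform_im (M : Matrix n n ℝ) (hM : M.IsSymm) (x : n → ℂ) : (sform M x x).im = 0 :=
  Complex.conj_eq_iff_im.1 (star_sform M hM x x)

theorem sform_one [DecidableEq n] (x : n → ℂ) :
    sform (1 : Matrix n n ℝ) x x = (∑ i, ‖x i‖ ^ 2 : ℝ) := by
  simp only [sform_eq_sum, Matrix.one_apply]
  push_cast
  refine Finset.sum_congr rfl fun i _ => ?_
  rw [Finset.sum_eq_single i (fun j _ hj => by simp [hj.symm]) (by simp)]
  rw [← Complex.mul_conj']
  simp [mul_comm]

/-- Real semidefiniteness only tests real vectors; at `a + jb` the real part of the form is `aᵀMa +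
bᵀMb`. -/
theorem sform_re_nonneg {M : Matrix n n ℝ} (hM : M.PosSemidef) (x : n → ℂ) :
    0 ≤ (sform M x x).re := by
  have h1 := hM.dotProduct_mulVec_nonneg fun i => (x i).re
  have h2 := hM.dotProduct_mulVec_nonneg fun i => (x i).im
  refine (add_nonneg h1 h2).trans_eq ?_
  rw [sform_eq_sum]
  simp only [dotProduct, Matrix.mulVec, Finset.mul_sum, Complex.re_sum, Pi.star_apply,
    star_trivial, ← Finset.sum_add_distrib]
  refine Finset.sum_congr rfl fun i _ => Finset.sum_congr rfl fun j _ => ?_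
  simp only [RCLike.star_def, Complex.mul_re, Complex.mul_im, Complex.conj_re,
    Complex.conj_im, Complex.ofReal_re, Complex.ofReal_im]
  ring

end sform

/-- The first `N` entries. -/
def front {N : ℕ} (x : Fin (N + 1) → ℂ) : Fin N → ℂ := fun i => x i.castSucc

/-- The last `N` entries. -/
def back {N : ℕ} (x : Fin (N + 1) → ℂ) : Fin N → ℂ := fun i => x i.succ

/-- The Hermitian form of the upper left block of the bandpass matrix, up to the term `-γ²`. -/
noncomputable def bandForm {N : ℕ} (X Y : Matrix (Fin N) (Fin N) ℝ) (ω Ω : ℝ)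
    (x : Fin (N + 1) → ℂ) : ℂ :=
  sform X (back x) (back x) - sform X (front x) (front x)
    + Complex.exp (-(ω * Complex.I)) * sform Y (front x) (back x)
    + Complex.exp (ω * Complex.I) * sform Y (back x) (front x)
    - ((2 * Real.cos Ω : ℝ) : ℂ) * sform Y (front x) (front x)

theorem bandForm_add {N : ℕ} (X Y X' Y' : Matrix (Fin N) (Fin N) ℝ) (ω Ω : ℝ)
    (x : Fin (N + 1) → ℂ) :
    bandForm (X + X') (Y + Y') ω Ω x = bandForm X Y ω Ω x + bandForm X' Y' ω Ω x := by
  simp only [bandForm, sform_add]; ring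

/-- A congruence compatible with both truncations carries band forms to band forms; Toeplitz
matrices have this property. -/
theorem bandForm_lift {N n : ℕ} (X Y : Matrix (Fin n) (Fin n) ℝ) (ω Ω : ℝ)
    (R : Matrix (Fin (N + 1)) (Fin (n + 1)) ℝ) (R' : Matrix (Fin N) (Fin n) ℝ)
    (x : Fin (N + 1) → ℂ)
    (hf : front ((toC R)ᵀ *ᵥ x) = (toC R')ᵀ *ᵥ front x)
    (hb : back ((toC R)ᵀ *ᵥ x) = (toC R')ᵀ *ᵥ back x) :
    bandForm (R' * X * R'ᵀ) (R' * Y * R'ᵀ) ω Ω x = bandForm X Y ω Ω ((toC R)ᵀ *ᵥ x) := by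
  simp only [bandForm, sform_mul_mul_transpose, hf, hb]

/-- The geometric vector `(1, z, …, z^N)` with `z = e^{jθ}`. -/
noncomputable def geom (N : ℕ) (θ : ℝ) : Fin (N + 1) → ℂ :=
  fun i => Complex.exp (θ * Complex.I) ^ (i : ℕ)

/-- `p(cos θ)` has a real Gram matrix dominating a band form with positive semidefinite `Y`. -/
def BandCert (N : ℕ) (ω Ω : ℝ) (p : ℝ[X]) : Prop :=
  ∃ (D : Matrix (Fin (N + 1)) (Fin (N + 1)) ℝ) (X Y : Matrix (Fin N) (Fin N) ℝ),
    D.IsSymm ∧ X.IsSymm ∧ Y.IsSymm ∧ Y.PosSemidef ∧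
    (∀ x, 0 ≤ (sform D x x - bandForm X Y ω Ω x).re) ∧
    ∀ θ, (sform D (geom N θ) (geom N θ)).re = p.eval (Real.cos θ)

theorem BandCert.zero (N : ℕ) (ω Ω : ℝ) : BandCert N ω Ω 0 :=
  ⟨0, 0, 0, Matrix.isSymm_zero, Matrix.isSymm_zero, Matrix.isSymm_zero, .zero,
    by simp [bandForm], by simp⟩

theorem BandCert.add {N : ℕ} {ω Ω : ℝ} {p q : ℝ[X]} (hp : BandCert N ω Ω p)
    (hq : BandCert N ω Ω q) : BandCert N ω Ω (p + q) := by
  obtain ⟨D, X, Y, hD, hX, hY, hY0, h, hv⟩ := hp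
  obtain ⟨D', X', Y', hD', hX', hY', hY0', h', hv'⟩ := hq
  refine ⟨D + D', X + X', Y + Y', hD.add hD', hX.add hX', hY.add hY', hY0.add hY0', ?_, ?_⟩
  · intro x
    have := add_nonneg (h x) (h' x)
    rw [sform_add, bandForm_add]
    simp only [Complex.sub_re, Complex.add_re] at this ⊢
    linarith
  · intro θ
    rw [sform_add, Complex.add_re, hv, hv', eval_add]

/-- The Toeplitz matrix of multiplication by `q`. -/
noncomputable def mulMatrix (q : ℝ[X]) (N n : ℕ) : Matrix (Fin N) (Fin n) ℝ :=
  Matrix.of fun i k => (X ^ (k : ℕ) * q).coeff i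

theorem front_mulMatrix {N n : ℕ} {q : ℝ[X]} (hq : q.natDegree + n ≤ N) (x : Fin (N + 1) → ℂ) :
    front ((toC (mulMatrix q (N + 1) (n + 1)))ᵀ *ᵥ x) = (toC (mulMatrix q N n))ᵀ *ᵥ front x := by
  ext k
  -- Dropping the last entry is harmless because `k < n` keeps the degree below `N`. For `back` the
  -- dropped coefficient is the constant one of `X^(k+1) q`, so no degree bound is needed there.
  have h : (X ^ (k : ℕ) * q).coeff N = 0 := by
    apply coeff_eq_zero_of_natDegree_lt
    have := natDegree_mul_le (p := X ^ (k : ℕ)) (q := q)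
    rw [natDegree_X_pow] at this
    have := k.2
    omega
  simp [front, Matrix.mulVec, dotProduct, Fin.sum_univ_castSucc, toC, mulMatrix, h]

theorem back_mulMatrix {N n : ℕ} {q : ℝ[X]} (x : Fin (N + 1) → ℂ) :
    back ((toC (mulMatrix q (N + 1) (n + 1)))ᵀ *ᵥ x) = (toC (mulMatrix q N n))ᵀ *ᵥ back x := by
  ext k
  simp [back, Matrix.mulVec, dotProduct, Fin.sum_univ_succ, toC, mulMatrix, pow_succ', mul_assoc]

/-- Column `k` holds the coefficients of `X^k q`, whose value at `z` is `z^k q(z)`. -/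
theorem mulMatrix_geom {N n : ℕ} {q : ℝ[X]} (hq : q.natDegree + n ≤ N) (θ : ℝ) :
    (toC (mulMatrix q (N + 1) (n + 1)))ᵀ *ᵥ geom N θ =
      (aeval (Complex.exp (θ * Complex.I)) q) • geom n θ := by
  ext k
  have h : (X ^ (k : ℕ) * q).natDegree < N + 1 := by
    have := natDegree_mul_le (p := X ^ (k : ℕ)) (q := q)
    rw [natDegree_X_pow] at this
    have := k.2
    omega
  have h2 := aeval_eq_sum_range' h (Complex.exp (θ * Complex.I))
  simp only [map_mul, map_pow, aeval_X] at h2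
  simp only [Pi.smul_apply, smul_eq_mul, geom]
  rw [mul_comm, h2, Finset.sum_range]
  simp [Matrix.mulVec, dotProduct, toC, mulMatrix, geom]

/-- Clearing denominators in `r((z + z⁻¹) / 2)`. -/
theorem exists_norm_aeval_exp_eq (r : ℝ[X]) {m : ℕ} (hr : r.natDegree ≤ m) :
    ∃ q : ℝ[X], q.natDegree ≤ 2 * m ∧
      ∀ θ : ℝ, ‖aeval (Complex.exp (θ * Complex.I)) q‖ ^ 2 = r.eval (Real.cos θ) ^ 2 := by
  -- The witness is `z^m r((z + z⁻¹) / 2)`, and `|z^m| = 1` on the circle.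
  refine ⟨∑ k ∈ Finset.range (m + 1), C (r.coeff k / 2 ^ k) * ((X ^ 2 + 1) ^ k * X ^ (m - k)),
    ?_, ?_⟩
  · refine natDegree_sum_le_of_forall_le _ _ fun k hk => ?_
    have hk' := Finset.mem_range.1 hk
    refine (natDegree_C_mul_le _ _).trans (natDegree_mul_le.trans ?_)
    rw [natDegree_X_pow]
    have h1 : (X ^ 2 + 1 : ℝ[X]).natDegree ≤ 2 := by compute_degree
    have h2 : ((X ^ 2 + 1 : ℝ[X]) ^ k).natDegree ≤ k * 2 :=
      natDegree_pow_le.trans (Nat.mul_le_mul_left k h1)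
    omega
  · intro θ
    set z := Complex.exp (θ * Complex.I) with hz
    have hcos : z ^ 2 + 1 = 2 * (Real.cos θ : ℂ) * z := by
      have : z * Complex.exp (-(θ * Complex.I)) = 1 := by
        rw [hz, ← Complex.exp_add, add_neg_cancel, Complex.exp_zero]
      rw [Complex.ofReal_cos, Complex.cos, ← hz, neg_mul]
      linear_combination -this
    have hval : aeval z (∑ k ∈ Finset.range (m + 1),
        C (r.coeff k / 2 ^ k) * ((X ^ 2 + 1) ^ k * X ^ (m - k))) =
        z ^ m * ((r.eval (Real.cos θ) : ℝ) : ℂ) := by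
      rw [eval_eq_sum_range' (Nat.lt_succ_of_le hr)]
      push_cast
      rw [map_sum, Finset.mul_sum]
      refine Finset.sum_congr rfl fun k hk => ?_
      have hk' : k ≤ m := Nat.lt_succ_iff.1 (Finset.mem_range.1 hk)
      simp only [map_mul, map_pow, map_add, aeval_X, aeval_C, map_one, hcos, mul_pow]
      rw [← Nat.sub_add_cancel hk', pow_add, Nat.sub_add_cancel hk']
      have h2 : (2 : ℂ) ^ k ≠ 0 := by positivity
      simp
      field_simp
    rw [hval, norm_mul, norm_pow, hz, Complex.norm_exp_ofReal_mul_I, one_pow, one_mul,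
      Complex.norm_real, Real.norm_eq_abs, sq_abs]

/-- Congruence by the Toeplitz matrix of `q` multiplies the trigonometric polynomial by
`|q(e^{jθ})|² = r(cos θ)²` and preserves the other conditions. -/
theorem BandCert.mul_sq {N n : ℕ} {ω Ω : ℝ} {g : ℝ[X]} (hg : BandCert n ω Ω g) {m : ℕ}
    {r : ℝ[X]} (hr : r.natDegree ≤ m) (h : 2 * m + n ≤ N) : BandCert N ω Ω (g * r ^ 2) := by
  obtain ⟨D, X, Y, hD, hX, hY, hY0, hpos, hv⟩ := hg
  obtain ⟨q, hq, hqr⟩ := exists_norm_aeval_exp_eq r hr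
  have hdeg : q.natDegree + n ≤ N := by omega
  have hsymm : ∀ {k l : ℕ} (P : Matrix (Fin k) (Fin l) ℝ) {M : Matrix (Fin l) (Fin l) ℝ},
      M.IsSymm → (P * M * Pᵀ).IsSymm := by
    intro k l P M hM
    rw [Matrix.IsSymm, Matrix.transpose_mul, Matrix.transpose_mul, Matrix.transpose_transpose,
      hM.eq, Matrix.mul_assoc]
  refine ⟨mulMatrix q (N + 1) (n + 1) * D * (mulMatrix q (N + 1) (n + 1))ᵀ,
    mulMatrix q N n * X * (mulMatrix q N n)ᵀ, mulMatrix q N n * Y * (mulMatrix q N n)ᵀ,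
    hsymm _ hD, hsymm _ hX, hsymm _ hY, ?_, ?_, ?_⟩
  · have := hY0.mul_mul_conjTranspose_same (mulMatrix q N n)
    rwa [Matrix.conjTranspose_eq_transpose_of_trivial] at this
  · intro x
    rw [sform_mul_mul_transpose,
      bandForm_lift X Y ω Ω _ _ x (front_mulMatrix hdeg x) (back_mulMatrix x)]
    exact hpos _
  · intro θ
    rw [sform_mul_mul_transpose, mulMatrix_geom hdeg, sform_smul_vec, Complex.re_ofReal_mul, hv,
      hqr, eval_mul, eval_pow, mul_comm]

end BandLMI

/-! ### Explicit certificates in degrees zero, one and two. -/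

namespace BandLMI

open Polynomial
open MultiBand (toC)

theorem geom_eq (N : ℕ) (θ : ℝ) (i : Fin (N + 1)) :
    geom N θ i = Real.cos ((i : ℕ) * θ) + Real.sin ((i : ℕ) * θ) * Complex.I := by
  rw [geom, ← Complex.exp_nat_mul, ← mul_assoc]
  rw [show ((i : ℕ) : ℂ) * (θ : ℂ) = (((i : ℕ) * θ : ℝ) : ℂ) by push_cast; rfl,
    Complex.exp_mul_I, Complex.ofReal_cos, Complex.ofReal_sin]

theorem exp_eq (ω : ℝ) : Complex.exp (ω * Complex.I) = Real.cos ω + Real.sin ω * Complex.I := by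
  rw [Complex.exp_mul_I, Complex.ofReal_cos, Complex.ofReal_sin]

theorem exp_neg_eq (ω : ℝ) :
    Complex.exp (-(ω * Complex.I)) = Real.cos ω - Real.sin ω * Complex.I := by
  rw [← neg_mul, Complex.exp_mul_I, Complex.cos_neg, Complex.sin_neg, Complex.ofReal_cos,
    Complex.ofReal_sin]
  ring

theorem bandCert_one (ω Ω : ℝ) : BandCert 0 ω Ω 1 := by
  refine ⟨1, 0, 0, Matrix.isSymm_one, Matrix.isSymm_zero, Matrix.isSymm_zero, .zero, ?_, ?_⟩
  · intro x
    simp only [bandForm, sform_zero, sform_one, mul_zero, sub_zero, add_zero, Complex.ofReal_re]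
    positivity
  · intro θ
    rw [sform_one]
    simp [geom]

theorem posSemidef_fin_one {k : ℝ} (hk : 0 ≤ k) :
    (Matrix.of fun _ _ => k : Matrix (Fin 1) (Fin 1) ℝ).PosSemidef := by
  have := (Matrix.PosSemidef.one (n := Fin 1) (R := ℝ)).smul hk
  convert this using 1
  ext i j; simp [Subsingleton.elim i j]

theorem sform_fin_two (a b c d : ℝ) (x y : Fin (1 + 1) → ℂ) :
    sform !![a, b; c, d] x y = a * (star (x 0) * y 0) + b * (star (x 0) * y 1)
      + (c * (star (x 1) * y 0) + d * (star (x 1) * y 1)) := by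
  refine (sform_eq_sum (n := Fin 2) _ x y).trans ?_
  simp [Fin.sum_univ_two]

theorem sform_fin_three (a b c d e f g h k : ℝ) (x y : Fin (2 + 1) → ℂ) :
    sform !![a, b, c; d, e, f; g, h, k] x y =
      a * (star (x 0) * y 0) + b * (star (x 0) * y 1) + c * (star (x 0) * y 2)
      + (d * (star (x 1) * y 0) + e * (star (x 1) * y 1) + f * (star (x 1) * y 2))
      + (g * (star (x 2) * y 0) + h * (star (x 2) * y 1) + k * (star (x 2) * y 2)) := by
  refine (sform_eq_sum (n := Fin 3) _ x y).trans ?_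
  simp [Fin.sum_univ_three]

/-- The certificate of a degree one polynomial `e (X - cos φ)` whose slack is the multiple
`κ / 2` of `|x₁ - e^{jφ} x₀|²`. -/
theorem bandCert_linear {ω Ω φ e κ k : ℝ} (hκ : 0 ≤ κ) (hk : 0 ≤ k)
    (h1 : 2 * k * Real.cos ω = e + κ * Real.cos φ) (h2 : 2 * k * Real.sin ω = κ * Real.sin φ)
    (h3 : 2 * k * Real.cos Ω = e * Real.cos φ + κ) :
    BandCert 1 ω Ω (C e * (X - C (Real.cos φ))) := by
  refine ⟨!![-(e * Real.cos φ), e / 2; e / 2, 0], Matrix.of fun _ _ => -κ / 2,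
    Matrix.of fun _ _ => k, ?_, rfl, rfl, posSemidef_fin_one hk, ?_, ?_⟩
  · ext i j; fin_cases i <;> fin_cases j <;> rfl
  · intro x
    have key : 0 ≤ κ / 2 *
        (((x 1).re - (Real.cos φ * (x 0).re - Real.sin φ * (x 0).im)) ^ 2 +
        ((x 1).im - (Real.cos φ * (x 0).im + Real.sin φ * (x 0).re)) ^ 2) := by positivity
    refine key.trans_eq ?_
    have hφ := Real.sin_sq_add_cos_sq φ
    rw [sform_fin_two]
    simp only [bandForm, sform_eq_sum, exp_eq, exp_neg_eq, front, back,
      Finset.univ_unique, Finset.sum_singleton, Fin.default_eq_zero, Matrix.of_apply,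
      Fin.castSucc_zero, Fin.succ_zero_eq_one]
    simp only [RCLike.star_def, Complex.mul_re, Complex.mul_im, Complex.conj_re,
      Complex.conj_im, Complex.ofReal_re, Complex.ofReal_im, Complex.add_re, Complex.add_im,
      Complex.sub_re, Complex.sub_im, Complex.I_re, Complex.I_im]
    linear_combination (κ / 2 * ((x 0).re ^ 2 + (x 0).im ^ 2)) * hφ
      + ((x 0).re * (x 1).re + (x 0).im * (x 1).im) * h1
      + ((x 0).re * (x 1).im - (x 0).im * (x 1).re) * h2
      - ((x 0).re ^ 2 + (x 0).im ^ 2) * h3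
  · intro θ
    have hθ := Real.sin_sq_add_cos_sq θ
    rw [sform_fin_two]
    simp only [geom_eq]
    simp [-Complex.ofReal_sin, -Complex.ofReal_cos]
    ring

/-- The constants solve `2k e^{jω} = e + κ e^{jφ}`, a triangle whose sides come from the law of
sines. Its product with `e^{-jφ}` has the third required identity as real part. -/
theorem bandCert_X_sub_C {ω Ω : ℝ} (hω : 0 ≤ Real.sin ω) (hΩ : 0 < Real.sin Ω)
    (hs : 0 ≤ Real.sin (ω + Ω)) : BandCert 1 ω Ω (X - C (Real.cos (ω + Ω))) := by
  have := bandCert_linear (ω := ω) (Ω := Ω) (φ := ω + Ω) (e := 1)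
    (κ := Real.sin ω / Real.sin Ω) (k := Real.sin (ω + Ω) / Real.sin Ω / 2)
    (by positivity) (by positivity) ?_ ?_ ?_
  · simpa using this
  all_goals
    rw [Real.sin_add]
    try rw [Real.cos_add]
    have h1 := Real.sin_sq_add_cos_sq ω
    have h2 := Real.sin_sq_add_cos_sq Ω
    field_simp
  · linear_combination (Real.sin Ω) * h1
  · linear_combination (Real.sin ω) * h2

theorem bandCert_C_sub_X {ω Ω : ℝ} (hω : 0 ≤ Real.sin ω) (hΩ : 0 < Real.sin Ω)
    (hs : 0 ≤ Real.sin (ω - Ω)) : BandCert 1 ω Ω (C (Real.cos (ω - Ω)) - X) := by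
  have := bandCert_linear (ω := ω) (Ω := Ω) (φ := ω - Ω) (e := -1)
    (κ := Real.sin ω / Real.sin Ω) (k := Real.sin (ω - Ω) / Real.sin Ω / 2)
    (by positivity) (by positivity) ?_ ?_ ?_
  · simpa using this
  all_goals
    rw [Real.sin_sub]
    try rw [Real.cos_sub]
    have h1 := Real.sin_sq_add_cos_sq ω
    have h2 := Real.sin_sq_add_cos_sq Ω
    field_simp
  · linear_combination (-Real.sin Ω) * h1
  · linear_combination (Real.sin ω) * h2

/-- On geometric vectors, with `X = 0`, `Y` contributes `2 (cos (θ - ω) - cos Ω)(cos Ω - cos ω cos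
θ)` and the slack is `(cos (θ - ω) - cos Ω)²`. Their sum is `(cos (θ - ω) - cos Ω)(cos Ω - cos (θ +
ω))`, which is the given product. The hypothesis is exactly semidefiniteness of `Y`. -/
theorem bandCert_quadratic {ω Ω : ℝ} (h : |Real.cos ω| ≤ Real.cos Ω) :
    BandCert 2 ω Ω ((X - C (Real.cos (ω + Ω))) * (C (Real.cos (ω - Ω)) - X)) := by
  have h1 := Real.sin_sq_add_cos_sq ω
  have h2 := Real.sin_sq_add_cos_sq Ω
  refine ⟨!![1 / 4 - Real.cos Ω ^ 2, Real.cos ω * Real.cos Ω, -1 / 4;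
      Real.cos ω * Real.cos Ω, -Real.cos ω ^ 2, 0; -1 / 4, 0, 1 / 4], 0,
    !![Real.cos Ω / 2, -Real.cos ω / 2; -Real.cos ω / 2, Real.cos Ω / 2], ?_,
    Matrix.isSymm_zero, ?_, ?_, ?_, ?_⟩
  · ext i j; fin_cases i <;> fin_cases j <;> rfl
  · ext i j; fin_cases i <;> fin_cases j <;> rfl
  · refine Matrix.PosSemidef.of_dotProduct_mulVec_nonneg ?_ fun x => ?_
    · ext i j; fin_cases i <;> fin_cases j <;> rfl
    · simp [dotProduct, Matrix.mulVec, Fin.sum_univ_two]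
      nlinarith [mul_nonneg (sub_nonneg.2 (abs_le.1 h).2) (sq_nonneg (x 0 + x 1)),
        mul_nonneg (neg_le_iff_add_nonneg.1 (abs_le.1 h).1) (sq_nonneg (x 0 - x 1)),
        mul_nonneg (sub_nonneg.2 (abs_le.1 h).2) (sq_nonneg (x 0 - x 1)),
        mul_nonneg (neg_le_iff_add_nonneg.1 (abs_le.1 h).1) (sq_nonneg (x 0 + x 1))]
  · intro x
    -- The slack is the rank-one form `|f|² / 4`; `f` vanishes on the geometric vectors of the band
    -- edges `θ = ω ± Ω`.
    set f : ℂ := Complex.exp (ω * Complex.I) * x 0 - 2 * Real.cos Ω * x 1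
      + Complex.exp (-(ω * Complex.I)) * x 2 with hf
    have key : 0 ≤ (f.re ^ 2 + f.im ^ 2) / 4 := by positivity
    refine key.trans_eq ?_
    rw [hf]
    rw [sform_fin_three]
    simp only [bandForm, sform_zero]
    rw [sform_fin_two, sform_fin_two, sform_fin_two]
    simp only [exp_eq, exp_neg_eq, front, back,
      Fin.castSucc_zero, Fin.castSucc_one, Fin.succ_zero_eq_one, Fin.succ_one_eq_two]
    simp only [RCLike.star_def, Complex.mul_re, Complex.mul_im, Complex.conj_re,
      Complex.conj_im, Complex.ofReal_re, Complex.ofReal_im, Complex.add_re, Complex.add_im,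
      Complex.sub_re, Complex.sub_im, Complex.I_re, Complex.I_im, Complex.re_ofNat,
      Complex.im_ofNat]
    linear_combination (((x 0).re ^ 2 + (x 0).im ^ 2 + (x 2).re ^ 2 + (x 2).im ^ 2) / 4
      - ((x 0).re * (x 2).re + (x 0).im * (x 2).im) / 2) * h1
  · intro θ
    have hθ := Real.sin_sq_add_cos_sq θ
    rw [sform_fin_three]
    simp only [geom_eq]
    simp only [Fin.val_zero, Fin.val_one, Fin.val_two, Nat.cast_zero, Nat.cast_one, Nat.cast_ofNat,
      zero_mul, one_mul, Real.cos_two_mul, Real.sin_two_mul, Real.cos_zero, Real.sin_zero,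
      RCLike.star_def, Complex.mul_re, Complex.mul_im, Complex.conj_re,
      Complex.conj_im, Complex.ofReal_re, Complex.ofReal_im, Complex.add_re, Complex.add_im,
      Complex.I_re, Complex.I_im, eval_mul, eval_sub, eval_X,
      eval_C, Real.cos_add, Real.cos_sub]
    linear_combination (Real.cos θ ^ 2 - Real.cos ω ^ 2) * hθ - (1 - Real.cos Ω ^ 2) * h1
      - Real.sin ω ^ 2 * h2

end BandLMI

/-! ### From the cone to certificates; Gram matrices of one trigonometric polynomial. -/

namespace BandLMI

open Polynomial IntervalPositivity
open MultiBand (toC)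

/-- The even parts of the exponents `e, f` go into the square, leaving four base cases with
exponents 0 or 1. The position of the band in `[0, π]` supplies their sign conditions. -/
theorem bandCert_of_mem_intervalCone {N : ℕ} {ω Ω : ℝ} (hΩ : 0 < Ω) (h0 : Ω ≤ ω)
    (hπ : ω + Ω ≤ Real.pi) {p : ℝ[X]}
    (hp : p ∈ intervalCone (Real.cos (ω + Ω)) (Real.cos (ω - Ω)) N) : BandCert N ω Ω p := by
  have hsω : 0 ≤ Real.sin ω := Real.sin_nonneg_of_nonneg_of_le_pi (by linarith) (by linarith)
  have hsΩ : 0 < Real.sin Ω := Real.sin_pos_of_pos_of_lt_pi hΩ (by linarith)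
  have hsa : 0 ≤ Real.sin (ω + Ω) := Real.sin_nonneg_of_nonneg_of_le_pi (by linarith) hπ
  have hsb : 0 ≤ Real.sin (ω - Ω) :=
    Real.sin_nonneg_of_nonneg_of_le_pi (by linarith) (by linarith)
  have habs : |Real.cos ω| ≤ Real.cos Ω := by
    refine abs_le.2 ⟨?_, Real.cos_le_cos_of_nonneg_of_le_pi hΩ.le (by linarith) h0⟩
    rw [neg_le, ← Real.cos_pi_sub]
    exact Real.cos_le_cos_of_nonneg_of_le_pi hΩ.le (by linarith) (by linarith)
  unfold intervalCone at hp
  induction hp using AddSubmonoid.closure_induction with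
  | zero => exact .zero _ _ _
  | add x y _ _ hx hy => exact hx.add hy
  | mem x hx =>
    obtain ⟨m, e, f, r, hr, h, rfl⟩ := hx
    set u := X - C (Real.cos (ω + Ω)) with hu
    set v := C (Real.cos (ω - Ω)) - X with hv
    have hdu : u.natDegree ≤ 1 := by rw [hu]; compute_degree
    have hdv : v.natDegree ≤ 1 := by rw [hv]; compute_degree
    have hd : (u ^ (e / 2) * v ^ (f / 2) * r).natDegree ≤ e / 2 + f / 2 + m := by
      refine natDegree_mul_le.trans (add_le_add (natDegree_mul_le.trans (add_le_add ?_ ?_)) hr)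
      · exact natDegree_pow_le.trans (by simpa using Nat.mul_le_mul_left (e / 2) hdu)
      · exact natDegree_pow_le.trans (by simpa using Nat.mul_le_mul_left (f / 2) hdv)
    have hsplit : u ^ e * v ^ f * r ^ 2 =
        u ^ (e % 2) * v ^ (f % 2) * (u ^ (e / 2) * v ^ (f / 2) * r) ^ 2 := by
      conv_lhs => rw [← Nat.mod_add_div e 2, ← Nat.mod_add_div f 2]
      rw [pow_add, pow_add, pow_mul', pow_mul']
      ring
    rw [hsplit]
    have hg : BandCert (e % 2 + f % 2) ω Ω (u ^ (e % 2) * v ^ (f % 2)) := by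
      rcases Nat.mod_two_eq_zero_or_one e with he | he <;>
        rcases Nat.mod_two_eq_zero_or_one f with hf | hf <;> rw [he, hf]
      · simpa using bandCert_one ω Ω
      · simpa using bandCert_C_sub_X hsω hsΩ hsb
      · simpa using bandCert_X_sub_C hsω hsΩ hsa
      · simpa using bandCert_quadratic habs
    exact hg.mul_sq hd (by omega)

/-- The function of `θ` given by a real symmetric Gram matrix is a polynomial in `cos θ`. -/
theorem exists_eval_cos_eq {N : ℕ} (D : Matrix (Fin (N + 1)) (Fin (N + 1)) ℝ) :
    ∃ p : ℝ[X], p.natDegree ≤ N ∧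
      ∀ θ, (sform D (geom N θ) (geom N θ)).re = p.eval (Real.cos θ) := by
  refine ⟨∑ i : Fin (N + 1), ∑ j : Fin (N + 1),
    C (D i j) * Chebyshev.T ℝ ((j : ℕ) - (i : ℕ) : ℤ), ?_, fun θ => ?_⟩
  · refine natDegree_sum_le_of_forall_le _ _ fun i _ =>
      natDegree_sum_le_of_forall_le _ _ fun j _ => (natDegree_C_mul_le _ _).trans ?_
    rw [Chebyshev.natDegree_T]
    omega
  · simp only [sform_eq_sum, Complex.re_sum, eval_finsetSum, eval_mul, eval_C,
      Chebyshev.T_real_cos]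
    refine Finset.sum_congr rfl fun i _ => Finset.sum_congr rfl fun j _ => ?_
    rw [Complex.re_ofReal_mul, geom_eq, geom_eq]
    rw [Int.cast_sub, Int.cast_natCast, Int.cast_natCast, sub_mul, Real.cos_sub]
    simp only [RCLike.star_def, Complex.mul_re, Complex.mul_im, Complex.conj_re,
      Complex.conj_im, Complex.ofReal_re, Complex.ofReal_im, Complex.add_re, Complex.add_im,
      Complex.I_re, Complex.I_im]
    ring

theorem infinite_range_exp_mul_I :
    (Set.range fun θ : ℝ => Complex.exp (θ * Complex.I)).Infinite := by
  have hinj : Set.InjOn (fun θ : ℝ => Complex.exp (θ * Complex.I)) (Set.Ioo 0 1) := by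
    intro s hs t ht hst
    have h := congrArg Complex.re hst
    simp only [Complex.exp_ofReal_mul_I_re] at h
    have hπ := Real.pi_gt_three
    exact Real.injOn_cos ⟨hs.1.le, by linarith [hs.2]⟩ ⟨ht.1.le, by linarith [ht.2]⟩ h
  exact ((Set.Ioo_infinite one_pos).image hinj).mono (Set.image_subset_range _ _)

/-- If the trigonometric polynomial of a symmetric Gram matrix vanishes, then so do its diagonal
sums. -/
theorem sum_diagonal_eq_zero {N : ℕ} {E : Matrix (Fin (N + 1)) (Fin (N + 1)) ℝ} (hE : E.IsSymm)
    (h : ∀ θ, (sform E (geom N θ) (geom N θ)).re = 0) (d : ℕ) :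
    ∑ i : Fin (N + 1), ∑ j : Fin (N + 1), (if N + (j : ℕ) = d + (i : ℕ) then E i j else 0) = 0 := by
  -- On the circle `P(z)` is `z^N` times the form; the factor `z^N` removes negative exponents.
  -- Infinitely many roots force `P = 0`, and its coefficients are the diagonal sums.
  set P : ℂ[X] := ∑ i : Fin (N + 1), ∑ j : Fin (N + 1),
    C (E i j : ℂ) * X ^ (N + (j : ℕ) - (i : ℕ)) with hP
  have hroot : ∀ θ : ℝ, P.eval (Complex.exp (θ * Complex.I)) = 0 := by
    intro θ
    set z := Complex.exp (θ * Complex.I) with hz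
    have h0 : sform E (geom N θ) (geom N θ) = 0 := Complex.ext (h θ) (sform_im E hE _)
    have hzz : star z * z = 1 := by
      rw [mul_comm]
      exact (Complex.mul_conj' z).trans (by simp [hz, Complex.norm_exp_ofReal_mul_I])
    have : P.eval z = z ^ N * sform E (geom N θ) (geom N θ) := by
      simp only [hP, eval_finsetSum, eval_mul, eval_C, eval_pow, eval_X, sform_eq_sum,
        Finset.mul_sum, geom, ← hz]
      refine Finset.sum_congr rfl fun i _ => Finset.sum_congr rfl fun j _ => ?_
      have hi : (i : ℕ) ≤ N := Nat.lt_succ_iff.1 i.2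
      have h1 : z ^ (N + (j : ℕ)) = z ^ (N + (j : ℕ) - (i : ℕ)) * z ^ (i : ℕ) := by
        rw [← pow_add]; congr 1; omega
      have h2 : star (z ^ (i : ℕ)) * z ^ (i : ℕ) = 1 := by
        rw [star_pow, ← mul_pow, hzz, one_pow]
      calc _ = (E i j : ℂ) * (z ^ (N + (j : ℕ) - (i : ℕ)) * (star (z ^ (i : ℕ)) * z ^ (i : ℕ))) := by
              rw [h2, mul_one]
        _ = (E i j : ℂ) * (star (z ^ (i : ℕ)) * z ^ (N + (j : ℕ))) := by rw [h1]; ring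
        _ = _ := by rw [pow_add]; ring
    rw [this, h0, mul_zero]
  have hP0 : P = 0 := by
    refine eq_zero_of_infinite_isRoot P (infinite_range_exp_mul_I.mono ?_)
    rintro _ ⟨θ, rfl⟩
    exact hroot θ
  have hcoeff := congrArg (fun Q => (coeff Q d).re) hP0
  simp only [hP, finsetSum_coeff, coeff_C_mul_X_pow, coeff_zero, Complex.zero_re,
    Complex.re_sum] at hcoeff
  refine Eq.trans ?_ hcoeff
  refine Finset.sum_congr rfl fun i _ => Finset.sum_congr rfl fun j _ => ?_
  have hi : (i : ℕ) ≤ N := Nat.lt_succ_iff.1 i.2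
  by_cases hd : N + (j : ℕ) = d + (i : ℕ)
  · rw [if_pos hd, if_pos (by omega), Complex.ofReal_re]
  · rw [if_neg hd, if_neg (by omega), Complex.zero_re]

/-- The partial sums along diagonals of a matrix. -/
noncomputable def diagSum {N : ℕ} (E : Matrix (Fin (N + 1)) (Fin (N + 1)) ℝ) (i j : ℕ) : ℝ :=
  ∑ t ∈ Finset.range (min i j + 1),
    -- For `i, j ≤ N` the default 0 is never used, and `t ≤ min i j` prevents truncated subtraction.
    if h : i - t < N + 1 ∧ j - t < N + 1 then E ⟨i - t, h.1⟩ ⟨j - t, h.2⟩ else 0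

theorem diagSum_comm {N : ℕ} {E : Matrix (Fin (N + 1)) (Fin (N + 1)) ℝ} (hE : E.IsSymm)
    (i j : ℕ) : diagSum E i j = diagSum E j i := by
  unfold diagSum
  rw [min_comm]
  refine Finset.sum_congr rfl fun t _ => ?_
  by_cases h : i - t < N + 1 ∧ j - t < N + 1
  · rw [dif_pos h, dif_pos h.symm, hE.apply]
  · rw [dif_neg h, dif_neg fun h' => h h'.symm]

theorem diagSum_succ_succ {N : ℕ} (E : Matrix (Fin (N + 1)) (Fin (N + 1)) ℝ) (i j : Fin N) :
    diagSum E (i + 1) (j + 1) = E i.succ j.succ + diagSum E i j := by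
  unfold diagSum
  rw [Nat.add_min_add_right, Finset.sum_range_succ']
  have hi := i.2
  have hj := j.2
  rw [dif_pos ⟨by omega, by omega⟩, add_comm]
  congr 1
  refine Finset.sum_congr rfl fun t _ => ?_
  simp only [Nat.add_sub_add_right]

theorem diagSum_zero_left {N : ℕ} (E : Matrix (Fin (N + 1)) (Fin (N + 1)) ℝ) (j : Fin (N + 1)) :
    diagSum E 0 j = E 0 j := by
  have := j.2
  simp only [diagSum, Nat.zero_min, zero_add, Finset.range_one, Finset.sum_singleton, Nat.sub_zero]
  rw [dif_pos ⟨by omega, by omega⟩]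
  rfl

/-- In the last row the partial sum runs over a whole diagonal, so it vanishes. -/
theorem diagSum_last {N : ℕ} {E : Matrix (Fin (N + 1)) (Fin (N + 1)) ℝ} (hE : E.IsSymm)
    (h : ∀ θ, (sform E (geom N θ) (geom N θ)).re = 0) (j : Fin (N + 1)) :
    diagSum E N j = 0 := by
  have hj : (j : ℕ) ≤ N := Nat.lt_succ_iff.1 j.2
  refine Eq.trans ?_ (sum_diagonal_eq_zero hE h j)
  rw [diagSum, min_eq_right hj, ← Finset.sum_product']
  refine Finset.sum_of_injOn (fun t : ℕ => ((⟨N - t, by omega⟩, ⟨(j : ℕ) - t, by omega⟩) :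
    Fin (N + 1) × Fin (N + 1))) ?_ (fun _ _ => by simp) ?_ ?_
  · intro s hs t ht hst
    simp only [Finset.coe_range, Set.mem_Iio] at hs ht
    simp only [Prod.mk.injEq, Fin.mk.injEq] at hst
    omega
  · rintro ⟨i, k⟩ - hik
    refine if_neg fun hd => hik ⟨(j : ℕ) - k, ?_, ?_⟩
    · simp only [Finset.coe_range, Set.mem_Iio]; omega
    · ext <;> simp only at hd ⊢ <;> omega
  · intro t ht
    have ht' := Finset.mem_range.1 ht
    rw [dif_pos ⟨by omega, by omega⟩]
    exact (if_pos (by simp only; omega)).symm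

/-- A symmetric Gram matrix of the zero trigonometric polynomial is a difference of two diagonal
shifts of one symmetric matrix. -/
theorem exists_shift_eq {N : ℕ} {E : Matrix (Fin (N + 1)) (Fin (N + 1)) ℝ} (hE : E.IsSymm)
    (h : ∀ θ, (sform E (geom N θ) (geom N θ)).re = 0) :
    ∃ X : Matrix (Fin N) (Fin N) ℝ, X.IsSymm ∧
      ∀ x, sform E x x = sform X (back x) (back x) - sform X (front x) (front x) := by
  -- The partial sums satisfy `S(i+1, j+1) - S(i, j) = E(i+1, j+1)`, so `E` telescopes along
  -- diagonals.
  refine ⟨Matrix.of fun i j => -diagSum E i j, ?_, fun x => ?_⟩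
  · ext i j; simp [diagSum_comm hE i j]
  -- The last row and column of the partial sums vanish, so the sum over `front` extends to all `N +
  -- 1` indices.
  · have hf : sform (Matrix.of fun i j : Fin N => -diagSum E i j) (front x) (front x) =
        -∑ i : Fin (N + 1), ∑ j : Fin (N + 1), (diagSum E i j : ℂ) * (star (x i) * x j) := by
      have hl : ∀ j : Fin N, diagSum E N j = 0 := fun j => diagSum_last hE h j.castSucc
      have hr : ∀ i : Fin N, diagSum E i N = 0 := fun i => diagSum_comm hE i N ▸ hl i
      have hc : diagSum E N N = 0 := diagSum_last hE h (Fin.last N)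
      simp [sform_eq_sum, Fin.sum_univ_castSucc, hl, hr, hc, front]
    rw [hf, sform_eq_sum, sform_eq_sum]
    have h0 : ∀ i : Fin N, diagSum E (i + 1) 0 = E i.succ 0 := fun i => by
      rw [diagSum_comm hE, ← hE.apply]
      exact diagSum_zero_left E i.succ
    have h1 : ∀ j : Fin N, diagSum E 0 (j + 1) = E 0 j.succ :=
      fun j => diagSum_zero_left E j.succ
    have h2 : diagSum E 0 0 = E 0 0 := diagSum_zero_left E 0
    simp only [Fin.sum_univ_succ, Fin.val_zero, Fin.val_succ, h0, h1, h2, diagSum_succ_succ,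
      Matrix.of_apply, back, Complex.ofReal_add, Complex.ofReal_neg, add_mul, neg_mul,
      Finset.sum_add_distrib, Finset.sum_neg_distrib]
    ring

end BandLMI

/-! ### Positivity on the band versus domination of a band form. -/

namespace BandLMI

open Polynomial IntervalPositivity
open MultiBand (toC)

/-- A real symmetric Gram matrix whose trigonometric polynomial is nonnegative on the band dominates
a band form. -/
theorem exists_bandForm_le {N : ℕ} {ω Ω : ℝ} (hΩ : 0 < Ω) (h0 : Ω ≤ ω) (hπ : ω + Ω ≤ Real.pi)
    {D : Matrix (Fin (N + 1)) (Fin (N + 1)) ℝ} (hD : D.IsSymm)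
    (h : ∀ θ ∈ Set.Icc (ω - Ω) (ω + Ω), 0 ≤ (sform D (geom N θ) (geom N θ)).re) :
    ∃ X Y : Matrix (Fin N) (Fin N) ℝ, X.IsSymm ∧ Y.IsSymm ∧ Y.PosSemidef ∧
      ∀ x, 0 ≤ (sform D x x - bandForm X Y ω Ω x).re := by
  obtain ⟨p, hdeg, hp⟩ := exists_eval_cos_eq D
  have hab : Real.cos (ω + Ω) < Real.cos (ω - Ω) :=
    Real.cos_lt_cos_of_nonneg_of_le_pi (by linarith) hπ (by linarith)
  have hmem : p ∈ intervalCone (Real.cos (ω + Ω)) (Real.cos (ω - Ω)) N := by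
    refine mem_intervalCone_of_nonneg hab N p hdeg fun x hx => ?_
    have h1 : -1 ≤ x := (Real.neg_one_le_cos _).trans hx.1
    have h2 : x ≤ 1 := hx.2.trans (Real.cos_le_one _)
    rw [← Real.cos_arccos h1 h2, ← hp]
    refine h _ ⟨?_, ?_⟩
    · rw [← Real.arccos_cos (x := ω - Ω) (by linarith) (by linarith)]
      exact Real.arccos_le_arccos hx.2
    · rw [← Real.arccos_cos (x := ω + Ω) (by linarith) (by linarith)]
      exact Real.arccos_le_arccos hx.1
  obtain ⟨D', X, Y, hD', hX, hY, hY0, hpos, hv⟩ := bandCert_of_mem_intervalCone hΩ h0 hπ hmem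
  -- `D'` need not equal `D`, but both represent `p`, so the difference is a band form with `Y = 0`.
  obtain ⟨X', hX', hE⟩ := exists_shift_eq (E := D - D') (hD.sub hD') fun θ => by
    rw [sform_sub, Complex.sub_re, hp, hv, sub_self]
  refine ⟨X + X', Y, hX.add hX', hY, hY0, fun x => (hpos x).trans_eq ?_⟩
  have h1 := hE x
  have h2 := bandForm_add X Y X' 0 ω Ω x
  rw [add_zero] at h2
  rw [h2, bandForm, bandForm]
  simp only [sform_zero, sform_sub] at h1 ⊢
  congr 1
  linear_combination -h1

theorem sum_front_le {N : ℕ} (x : Fin (N + 1) → ℂ) :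
    ∑ i, ‖front x i‖ ^ 2 ≤ ∑ i, ‖x i‖ ^ 2 := by
  rw [Fin.sum_univ_castSucc]
  exact le_add_of_nonneg_right (by positivity)

theorem sum_back_le {N : ℕ} (x : Fin (N + 1) → ℂ) :
    ∑ i, ‖back x i‖ ^ 2 ≤ ∑ i, ‖x i‖ ^ 2 := by
  rw [Fin.sum_univ_succ]
  exact le_add_of_nonneg_left (by positivity)

theorem norm_sform_one_le {n : Type*} [Fintype n] [DecidableEq n] (x y : n → ℂ) :
    ‖sform (1 : Matrix n n ℝ) x y‖ ≤ (∑ i, ‖x i‖ ^ 2 + ∑ i, ‖y i‖ ^ 2) / 2 := by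
  have : sform (1 : Matrix n n ℝ) x y = ∑ i, star (x i) * y i := by
    have h1 : toC (1 : Matrix n n ℝ) = 1 := by
      ext i j; by_cases h : i = j <;> simp [toC, Matrix.one_apply, h]
    rw [sform, h1, Matrix.one_mulVec]
    rfl
  rw [this, ← Finset.sum_add_distrib, Finset.sum_div]
  refine (norm_sum_le _ _).trans (Finset.sum_le_sum fun i _ => ?_)
  rw [norm_mul, norm_star]
  nlinarith [sq_nonneg (‖x i‖ - ‖y i‖)]

/-- Each cross term costs at most `‖x‖²` and the cosine term at most `2‖x‖²`. -/
theorem bandForm_zero_one_re_le {N : ℕ} (ω Ω : ℝ) (x : Fin (N + 1) → ℂ) :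
    (bandForm 0 1 ω Ω x).re ≤ 4 * ∑ i, ‖x i‖ ^ 2 := by
  have hf := sum_front_le x
  have hb := sum_back_le x
  have h1 : (Complex.exp (-(ω * Complex.I)) * sform 1 (front x) (back x)).re ≤ ∑ i, ‖x i‖ ^ 2 := by
    refine (Complex.re_le_norm _).trans ?_
    rw [norm_mul, ← neg_mul, ← Complex.ofReal_neg, Complex.norm_exp_ofReal_mul_I, one_mul]
    linarith [norm_sform_one_le (front x) (back x)]
  have h2 : (Complex.exp (ω * Complex.I) * sform 1 (back x) (front x)).re ≤ ∑ i, ‖x i‖ ^ 2 := by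
    refine (Complex.re_le_norm _).trans ?_
    rw [norm_mul, Complex.norm_exp_ofReal_mul_I, one_mul]
    linarith [norm_sform_one_le (back x) (front x)]
  simp only [bandForm, sform_zero, sform_one, ← Complex.ofReal_mul, Complex.sub_re, Complex.add_re,
    Complex.ofReal_re, Complex.zero_re] at h1 h2 ⊢
  have h3 : 0 ≤ ∑ i, ‖front x i‖ ^ 2 := by positivity
  nlinarith [Real.neg_one_le_cos Ω]

theorem continuous_sform_geom {N : ℕ} (D : Matrix (Fin (N + 1)) (Fin (N + 1)) ℝ) :
    Continuous fun θ => (sform D (geom N θ) (geom N θ)).re := by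
  obtain ⟨p, -, hp⟩ := exists_eval_cos_eq D
  simp only [hp]
  exact p.continuous.comp Real.continuous_cos

/-- The strict version of `exists_bandForm_le`. -/
theorem exists_bandForm_lt {N : ℕ} {ω Ω : ℝ} (hΩ : 0 < Ω) (h0 : Ω ≤ ω) (hπ : ω + Ω ≤ Real.pi)
    {D : Matrix (Fin (N + 1)) (Fin (N + 1)) ℝ} (hD : D.IsSymm)
    (h : ∀ θ ∈ Set.Icc (ω - Ω) (ω + Ω), 0 < (sform D (geom N θ) (geom N θ)).re) :
    ∃ X Y : Matrix (Fin N) (Fin N) ℝ, X.IsSymm ∧ Y.IsSymm ∧ Y.PosDef ∧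
      ∀ x, x ≠ 0 → 0 < (sform D x x - bandForm X Y ω Ω x).re := by
  obtain ⟨θ₀, hθ₀, hmin⟩ := isCompact_Icc.exists_isMinOn
    (Set.nonempty_Icc.2 (by linarith : ω - Ω ≤ ω + Ω)) (continuous_sform_geom D).continuousOn
  set μ := (sform D (geom N θ₀) (geom N θ₀)).re with hμ
  have hμ0 : 0 < μ := h θ₀ hθ₀
  -- A geometric vector has squared norm `N + 1`, so `D - δ` is still nonnegative on the band.
  set δ := μ / (N + 1) with hδ
  have hδ0 : 0 < δ := by positivity
  obtain ⟨X, Y, hX, hY, hY0, hpos⟩ := exists_bandForm_le hΩ h0 hπ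
    (D := D - δ • 1) (hD.sub (Matrix.isSymm_one.smul δ)) fun θ hθ => by
      have h1 : μ ≤ (sform D (geom N θ) (geom N θ)).re := hmin hθ
      have h2 : ∑ i, ‖geom N θ i‖ ^ 2 = N + 1 := by
        simp [geom, Complex.norm_exp_ofReal_mul_I]
      rw [sform_sub, sform_smul, sform_one, h2, Complex.sub_re, ← Complex.ofReal_mul,
        Complex.ofReal_re, hδ, div_mul_cancel₀ _ (by positivity)]
      linarith
  -- Adding `δ / 8` to `Y` costs at most `4 · δ / 8 = δ / 2` of the reserve `δ`, so `δ / 2 · ‖x‖²`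
  -- remains.
  refine ⟨X, Y + (δ / 8) • 1, hX, hY.add (Matrix.isSymm_one.smul _),
    Matrix.PosDef.posSemidef_add hY0 (Matrix.PosDef.one.smul (by positivity)), fun x hx => ?_⟩
  have h1 := hpos x
  have h2 := bandForm_add X Y 0 ((δ / 8) • 1) ω Ω x
  have h3 : bandForm 0 ((δ / 8) • 1) ω Ω x = ((δ / 8 : ℝ) : ℂ) * bandForm 0 1 ω Ω x := by
    simp only [bandForm, sform_zero, sform_smul]; ring
  have h4 := bandForm_zero_one_re_le ω Ω x
  have h5 : 0 < ∑ i, ‖x i‖ ^ 2 := by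
    obtain ⟨i, hi⟩ := Function.ne_iff.1 hx
    exact Finset.sum_pos' (fun _ _ => by positivity)
      ⟨i, Finset.mem_univ i, by have := norm_pos_iff.2 hi; positivity⟩
  rw [add_zero] at h2
  rw [h2, h3]
  rw [sform_sub, sform_smul, sform_one] at h1
  simp only [Complex.sub_re, Complex.add_re, Complex.re_ofReal_mul, Complex.ofReal_re] at h1 ⊢
  nlinarith

/-- Here `back = z • front` with `|z| = 1`: the `X` terms cancel and `Y` is weighted by `2 (cos (θ -
ω) - cos Ω)`. -/
theorem bandForm_geom_re_nonneg {N : ℕ} {X Y : Matrix (Fin N) (Fin N) ℝ} (hY : Y.PosSemidef)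
    {ω Ω θ : ℝ} (hΩ : Ω ≤ Real.pi) (hθ : θ ∈ Set.Icc (ω - Ω) (ω + Ω)) :
    0 ≤ (bandForm X Y ω Ω (geom N θ)).re := by
  set z := Complex.exp (θ * Complex.I) with hz
  have hzn : ‖z‖ = 1 := Complex.norm_exp_ofReal_mul_I θ
  have hb : back (geom N θ) = z • front (geom N θ) := by
    ext i; simp [back, front, geom, pow_succ', hz]
  set u := front (geom N θ)
  have hsymm : Y.IsSymm := by
    have := hY.isHermitian
    rwa [Matrix.IsHermitian, Matrix.conjTranspose_eq_transpose_of_trivial] at this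
  have h1 : sform Y u (z • u) = z * sform Y u u := by
    simp [sform, Matrix.mulVec_smul]
  have h2 : sform Y (z • u) u = star z * sform Y u u := by
    simp [sform, smul_dotProduct]
  have hs : sform Y u u = ((sform Y u u).re : ℂ) := Complex.ext rfl (sform_im Y hsymm u)
  have hcos : Real.cos Ω ≤ Real.cos (θ - ω) := by
    rw [← Real.cos_abs (θ - ω)]
    exact Real.cos_le_cos_of_nonneg_of_le_pi (abs_nonneg _) hΩ
      (abs_le.2 ⟨by linarith [hθ.1], by linarith [hθ.2]⟩)
  have hnn := sform_re_nonneg hY u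
  rw [bandForm, hb, sform_smul_vec, hzn, h1, h2, hs, hz, exp_eq, exp_eq, exp_neg_eq]
  have : 0 ≤ 2 * (Real.cos (θ - ω) - Real.cos Ω) * (sform Y u u).re := by
    have := sub_nonneg.2 hcos
    positivity
  refine this.trans_eq ?_
  rw [Real.cos_sub]
  simp only [one_pow, Complex.ofReal_one, one_mul, zero_add, RCLike.star_def,
    Complex.mul_re, Complex.mul_im, map_add, map_mul, Complex.conj_ofReal, Complex.conj_I,
    Complex.ofReal_re, Complex.ofReal_im, Complex.add_re, Complex.add_im, Complex.neg_re,
    Complex.neg_im, Complex.sub_re, Complex.sub_im, Complex.I_re, Complex.I_im]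
  ring

end BandLMI

/-! ### The block matrix, its Schur complement and the final equivalence. -/

namespace BandLMI

open MultiBand

/-- The row `[α_N, …, α_1, 1]`. -/
noncomputable def tapRow {N : ℕ} (α : Fin (N + 1) → ℝ) : Fin (N + 1) → ℝ :=
  Fin.snoc (α := fun _ => ℝ) (fun i : Fin N => α i.rev.succ) 1

/-- The Gram matrix of `γ² - |1 + R|²`. -/
noncomputable def gramGap {N : ℕ} (α : Fin (N + 1) → ℝ) (γ : ℝ) :
    Matrix (Fin (N + 1)) (Fin (N + 1)) ℝ :=
  γ ^ 2 • Matrix.vecMulVec (Pi.single (Fin.last N) 1) (Pi.single (Fin.last N) 1)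
    - Matrix.vecMulVec (tapRow α) (tapRow α)

theorem sform_vecMulVec {n : Type*} [Fintype n] (c : n → ℝ) (x : n → ℂ) :
    sform (Matrix.vecMulVec c c) x x = (‖∑ i, (c i : ℂ) * x i‖ ^ 2 : ℝ) := by
  rw [Complex.ofReal_pow, ← Complex.conj_mul', map_sum, Finset.sum_mul_sum, sform_eq_sum]
  refine Finset.sum_congr rfl fun i _ => Finset.sum_congr rfl fun j _ => ?_
  simp [Matrix.vecMulVec_apply]
  ring

theorem sform_gramGap {N : ℕ} (α : Fin (N + 1) → ℝ) (γ : ℝ) (x : Fin (N + 1) → ℂ) :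
    sform (gramGap α γ) x x =
      (γ ^ 2 * ‖x (Fin.last N)‖ ^ 2 - ‖∑ i, (tapRow α i : ℂ) * x i‖ ^ 2 : ℝ) := by
  rw [gramGap, sform_sub, sform_smul, sform_vecMulVec, sform_vecMulVec,
    Finset.sum_eq_single (Fin.last N) (fun i _ hi => by simp [hi]) (by simp)]
  simp

theorem isSymm_gramGap {N : ℕ} (α : Fin (N + 1) → ℝ) (γ : ℝ) : (gramGap α γ).IsSymm := by
  ext i j
  simp [gramGap, Matrix.vecMulVec_apply, mul_comm]

theorem norm_tapRow_geom {N : ℕ} (α : Fin (N + 1) → ℝ) (hα : α 0 = 0) (θ : ℝ) :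
    ‖∑ i, (tapRow α i : ℂ) * geom N θ i‖ = gain α θ := by
  set z := Complex.exp (θ * Complex.I) with hz
  have hz0 : z ≠ 0 := Complex.exp_ne_zero _
  -- The taps are listed in reverse, which is multiplication by `z^N`; as `α 0 = 0`, the last entry
  -- 1 is the full constant term of `1 + R`.
  have : ∑ i, (tapRow α i : ℂ) * geom N θ i = z ^ N * ntf α z := by
    rw [ntf, fir, Fin.sum_univ_castSucc, Fin.sum_univ_succ, hα, mul_add, mul_one, add_comm]
    simp only [tapRow, Fin.snoc_castSucc, Fin.snoc_last, geom, ← hz, Fin.val_last,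
      Fin.val_castSucc, Complex.ofReal_one, one_mul, Complex.ofReal_zero, zero_mul, zero_add,
      Finset.mul_sum]
    congr 1
    rw [← Equiv.sum_comp Fin.revPerm]
    refine Finset.sum_congr rfl fun i _ => ?_
    have hi : N = (i.rev : ℕ) + (i + 1) := by rw [Fin.val_rev]; omega
    simp only [Fin.revPerm_apply, Fin.rev_rev, Fin.val_succ]
    have : z ^ N * z ^ (-((i + 1 : ℕ) : ℤ)) = z ^ (i.rev : ℕ) := by
      have hp : z ^ N = z ^ (i.rev : ℕ) * z ^ ((i : ℕ) + 1) := by rw [← pow_add, ← hi]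
      rw [zpow_neg, zpow_natCast, hp, mul_inv_cancel_right₀ (pow_ne_zero _ hz0)]
    rw [← this]
    ring
  rw [this, norm_mul, norm_pow, hz, Complex.norm_exp_ofReal_mul_I, one_pow, one_mul, gain]

/-- The vector with first block `x` and last entry `y`. -/
def stack {N : ℕ} (x : Fin (N + 1) → ℂ) (y : ℂ) : (Fin N ⊕ Fin 1) ⊕ Fin 1 → ℂ :=
  Sum.elim (Sum.elim (front x) fun _ => x (Fin.last N)) fun _ => y

theorem exists_stack {N : ℕ} (w : (Fin N ⊕ Fin 1) ⊕ Fin 1 → ℂ) : ∃ x y, w = stack x y := by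
  refine ⟨Fin.snoc (α := fun _ => ℂ) (fun i => w (.inl (.inl i))) (w (.inl (.inr 0))),
    w (.inr 0), ?_⟩
  ext ((i | i) | i)
  · simp [stack, front]
  · simp [stack, Subsingleton.elim i 0]
  · simp [stack, Subsingleton.elim i 0]

/-- The state update of a delay line: this identifies `A, B` with the truncations `front` and
`back`. -/
theorem A_mulVec_add_B_mulVec {N : ℕ} (x : Fin (N + 1) → ℂ) :
    toC (A N) *ᵥ front x + toC (B N) *ᵥ (fun _ => x (Fin.last N)) = back x := by
  ext i
  simp only [Pi.add_apply, Matrix.mulVec, dotProduct, toC, A, B, Matrix.map_apply, Matrix.of_apply,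
    Finset.univ_unique, Finset.sum_singleton, front, back]
  have hi := i.2
  by_cases h : (i : ℕ) + 1 = N
  · rw [Finset.sum_eq_zero fun j _ => by rw [if_neg (by omega)]; simp, if_pos h]
    have : i.succ = Fin.last N := Fin.ext (by simpa using h)
    simp [this]
  · rw [Finset.sum_eq_single (⟨i + 1, by omega⟩ : Fin N)
      (fun j _ hj => by rw [if_neg fun hj' => hj (Fin.ext hj')]; simp) (by simp), if_neg h]
    simp
    rfl

theorem star_dotProduct_toC_transpose_mulVec {m n : Type*} [Fintype m] [Fintype n]
    (P : Matrix m n ℝ) (u : n → ℂ) (v : m → ℂ) :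
    star u ⬝ᵥ (toC Pᵀ *ᵥ v) = star (toC P *ᵥ u) ⬝ᵥ v := by
  rw [Matrix.dotProduct_mulVec, Matrix.star_mulVec, toC_conjTranspose]

theorem toC_row_mulVec {N : ℕ} (α : Fin (N + 1) → ℝ) (x : Fin (N + 1) → ℂ) :
    (toC (C α) *ᵥ front x) 0 + x (Fin.last N) = ∑ i, (tapRow α i : ℂ) * x i := by
  simp [Fin.sum_univ_castSucc, Matrix.mulVec, dotProduct, toC, C, front, tapRow]

theorem isHermitian_lmi {N : ℕ} (α : Fin (N + 1) → ℝ) {X Y : Matrix (Fin N) (Fin N) ℝ}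
    (hX : X.IsSymm) (hY : Y.IsSymm) (ω Ω γ : ℝ) : (lmi α X Y ω Ω γ).IsHermitian := by
  have he : star (Complex.exp (ω * Complex.I)) = Complex.exp (-(ω * Complex.I)) := by
    rw [RCLike.star_def, ← Complex.exp_conj]
    simp
  have he' : star (Complex.exp (-(ω * Complex.I))) = Complex.exp (ω * Complex.I) := by
    rw [← he, star_star]
  refine .fromBlocks (.fromBlocks ?_ ?_ ?_) ?_ ?_
  · rw [Matrix.IsHermitian, M4]
    simp only [Matrix.conjTranspose_sub, Matrix.conjTranspose_add, Matrix.conjTranspose_smul,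
      toC_conjTranspose, Matrix.transpose_mul, Matrix.transpose_transpose, hX.eq, hY.eq, he, he',
      Matrix.mul_assoc]
    rw [RCLike.star_def, Complex.conj_ofReal]
    abel
  · rw [M5, M5bar]
    simp only [Matrix.conjTranspose_add, Matrix.conjTranspose_smul, toC_conjTranspose,
      Matrix.transpose_add, Matrix.transpose_smul, he', toC_transpose]
  · rw [Matrix.IsHermitian, M6]
    simp only [Matrix.conjTranspose_sub, Matrix.conjTranspose_smul,
      toC_conjTranspose, Matrix.transpose_mul, Matrix.transpose_transpose, hX.eq,
      Matrix.mul_assoc, Matrix.conjTranspose_one]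
    rw [RCLike.star_def, Complex.conj_ofReal]
  · rw [Matrix.conjTranspose_fromRows_eq_fromCols_conjTranspose, toC_conjTranspose,
      Matrix.transpose_transpose, Matrix.conjTranspose_one]
  · simp [Matrix.IsHermitian]

/-- Substituting `Af + Bb = back x` collapses the upper left block to the band form minus `γ²|b|²`;
completing the square in `y` gives the rest. -/
theorem star_dotProduct_lmi_mulVec {N : ℕ} (α : Fin (N + 1) → ℝ) {X Y : Matrix (Fin N) (Fin N) ℝ}
    (hX : X.IsSymm) (hY : Y.IsSymm) (ω Ω γ : ℝ) (x : Fin (N + 1) → ℂ) (y : ℂ) :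
    star (stack x y) ⬝ᵥ (lmi α X Y ω Ω γ *ᵥ stack x y) =
      bandForm X Y ω Ω x - sform (gramGap α γ) x x
        - (‖y - ∑ i, (tapRow α i : ℂ) * x i‖ ^ 2 : ℝ) := by
  set f := front x with hf
  set b : Fin 1 → ℂ := fun _ => x (Fin.last N) with hb
  set s := back x with hs
  have hsx : toC (A N) *ᵥ f + toC (B N) *ᵥ b = s := A_mulVec_add_B_mulVec x
  set ep := Complex.exp (ω * Complex.I)
  set em := Complex.exp (-(ω * Complex.I))
  set k : ℂ := ((2 * Real.cos Ω : ℝ) : ℂ)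
  have hrow1 : M4 X Y ω Ω *ᵥ f + M5 X Y ω *ᵥ b =
      toC (A N)ᵀ *ᵥ (toC X *ᵥ s) + em • toC Y *ᵥ s + ep • (toC (A N)ᵀ *ᵥ (toC Y *ᵥ f))
        - toC X *ᵥ f - k • (toC Y *ᵥ f) := by
    rw [← hsx]
    simp only [M4, M5, toC_mul, Matrix.add_mulVec, Matrix.sub_mulVec, Matrix.smul_mulVec,
      Matrix.mulVec_add, smul_add, ← Matrix.mulVec_mulVec]
    abel
  have hrow2 : (M5bar X Y ω)ᵀ *ᵥ f + M6 X (γ ^ 2) *ᵥ b =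
      toC (B N)ᵀ *ᵥ (toC X *ᵥ s) + ep • (toC (B N)ᵀ *ᵥ (toC Y *ᵥ f))
        - ((γ ^ 2 : ℝ) : ℂ) • b := by
    rw [← hsx]
    simp only [M5bar, M6, Matrix.transpose_add, Matrix.transpose_smul, ← toC_transpose,
      Matrix.transpose_mul, Matrix.transpose_transpose, hX.eq, hY.eq, toC_mul, Matrix.add_mulVec,
      Matrix.sub_mulVec, Matrix.smul_mulVec, Matrix.mulVec_add, ← Matrix.mulVec_mulVec,
      Matrix.one_mulVec]
    abel
  have hsum : star f ⬝ᵥ (M4 X Y ω Ω *ᵥ f + M5 X Y ω *ᵥ b)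
      + star b ⬝ᵥ ((M5bar X Y ω)ᵀ *ᵥ f + M6 X (γ ^ 2) *ᵥ b) =
      bandForm X Y ω Ω x - (γ ^ 2 : ℝ) * (star b ⬝ᵥ b) := by
    have hst : ∀ v, star s ⬝ᵥ v = star (toC (A N) *ᵥ f) ⬝ᵥ v + star (toC (B N) *ᵥ b) ⬝ᵥ v :=
      fun v => by rw [← hsx, star_add, add_dotProduct]
    rw [hrow1, hrow2, bandForm, ← hf, ← hs]
    simp only [sform, hst, dotProduct_add, dotProduct_sub, dotProduct_smul, smul_eq_mul,
      star_dotProduct_toC_transpose_mulVec]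
    ring
  have hrow := toC_row_mulVec α x
  rw [← hf] at hrow
  set v : Fin 1 → ℂ := fun _ => y
  have hK : Matrix.fromBlocks (M4 X Y ω Ω) (M5 X Y ω) (M5bar X Y ω)ᵀ (M6 X (γ ^ 2)) *ᵥ
      Sum.elim f b = Sum.elim (M4 X Y ω Ω *ᵥ f + M5 X Y ω *ᵥ b)
        ((M5bar X Y ω)ᵀ *ᵥ f + M6 X (γ ^ 2) *ᵥ b) := by
    rw [Matrix.fromBlocks_mulVec, Sum.elim_comp_inl, Sum.elim_comp_inr]
  have hstack : stack x y = Sum.elim (Sum.elim f b) v := rfl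
  rw [hstack, lmi, Matrix.fromBlocks_mulVec, Sum.elim_comp_inl, Sum.elim_comp_inr, hK,
    Matrix.fromRows_mulVec, Matrix.fromCols_mulVec_sumElim, Function.star_sumElim,
    Function.star_sumElim, sumElim_dotProduct_sumElim, dotProduct_add, sumElim_dotProduct_sumElim,
    sumElim_dotProduct_sumElim, hsum, star_dotProduct_toC_transpose_mulVec, sform_gramGap,
    Matrix.one_mulVec, Matrix.one_mulVec, Matrix.neg_mulVec, Matrix.one_mulVec, ← hrow]
  simp only [dotProduct, Finset.univ_unique, Finset.sum_singleton, Fin.default_eq_zero,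
    Pi.star_apply, Pi.add_apply, Pi.neg_apply, v, hb]
  push_cast
  simp only [← Complex.conj_mul', RCLike.star_def, map_add, map_sub]
  ring

theorem stack_eq_zero_iff {N : ℕ} {x : Fin (N + 1) → ℂ} {y : ℂ} :
    stack x y = 0 ↔ x = 0 ∧ y = 0 := by
  constructor
  · intro h
    refine ⟨funext fun i => ?_, congrFun h (.inr 0)⟩
    refine Fin.lastCases (congrFun h (.inl (.inr 0))) (fun j => ?_) i
    exact congrFun h (.inl (.inl j))
  · rintro ⟨rfl, rfl⟩
    ext ((i | i) | i) <;> rfl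

/-- Schur complement form of the bandpass inequality. -/
theorem negDef_lmi_iff {N : ℕ} (α : Fin (N + 1) → ℝ) {X Y : Matrix (Fin N) (Fin N) ℝ}
    (hX : X.IsSymm) (hY : Y.IsSymm) (ω Ω γ : ℝ) :
    NegDef (lmi α X Y ω Ω γ) ↔
      ∀ x, x ≠ 0 → 0 < (sform (gramGap α γ) x x - bandForm X Y ω Ω x).re := by
  have hH := (isHermitian_lmi α hX hY ω Ω γ).neg
  have hval : ∀ x y, star (stack x y) ⬝ᵥ ((-lmi α X Y ω Ω γ) *ᵥ stack x y) =
      sform (gramGap α γ) x x - bandForm X Y ω Ω x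
        + (‖y - ∑ i, (tapRow α i : ℂ) * x i‖ ^ 2 : ℝ) := fun x y => by
    rw [Matrix.neg_mulVec, dotProduct_neg, star_dotProduct_lmi_mulVec α hX hY]
    ring
  constructor
  · intro h x hx
    -- This last entry makes the completed square vanish.
    have h1 := h.dotProduct_mulVec_pos
      (x := stack x (∑ i, (tapRow α i : ℂ) * x i)) fun h0 => hx (stack_eq_zero_iff.1 h0).1
    rw [hval, sub_self, norm_zero] at h1
    simpa using (Complex.pos_iff.1 h1).1
  · intro h
    refine Matrix.PosDef.of_dotProduct_mulVec_pos hH fun w hw => ?_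
    refine Complex.pos_iff.2 ⟨?_, (hH.im_star_dotProduct_mulVec_self w).symm⟩
    obtain ⟨x, y, rfl⟩ := exists_stack w
    rw [hval, Complex.add_re, Complex.ofReal_re]
    by_cases hx : x = 0
    · subst hx
      have hy : y ≠ 0 := fun hy => hw (stack_eq_zero_iff.2 ⟨rfl, hy⟩)
      have : 0 < ‖y‖ := norm_pos_iff.2 hy
      have h0 : sform (gramGap α γ) 0 0 - bandForm X Y ω Ω 0 = 0 := by
        rw [sform_gramGap]
        simp [bandForm, sform, front, back, dotProduct]
      rw [h0]
      simp only [Pi.zero_apply, mul_zero, Finset.sum_const_zero, sub_zero, Complex.zero_re,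
        zero_add]
      positivity
    · have := h x hx
      positivity

theorem sform_gramGap_geom_re {N : ℕ} (α : Fin (N + 1) → ℝ) (hα : α 0 = 0) (γ θ : ℝ) :
    (sform (gramGap α γ) (geom N θ) (geom N θ)).re = γ ^ 2 - gain α θ ^ 2 := by
  rw [sform_gramGap, Complex.ofReal_re, norm_tapRow_geom α hα]
  simp [geom, Complex.norm_exp_ofReal_mul_I]

theorem gain_lt_iff {N : ℕ} (α : Fin (N + 1) → ℝ) (hα : α 0 = 0) {γ : ℝ} (hγ : 0 < γ) (θ : ℝ) :
    gain α θ < γ ↔ 0 < (sform (gramGap α γ) (geom N θ) (geom N θ)).re := by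
  rw [sform_gramGap_geom_re α hα, sub_pos]
  exact (sq_lt_sq₀ (norm_nonneg _) hγ.le).symm

theorem worstGain_lt_iff {N : ℕ} (α : Fin (N + 1) → ℝ) {a b γ : ℝ} (hab : a ≤ b) :
    worstGain α (Set.Icc a b) < γ ↔ ∀ θ ∈ Set.Icc a b, gain α θ < γ := by
  have h := worstGain_isGreatest α (isCompact_Icc (a := a) (b := b)) (Set.nonempty_Icc.2 hab)
  constructor
  · exact fun hlt θ hθ => (h.2 (Set.mem_image_of_mem _ hθ)).trans_lt hlt
  · intro hall
    obtain ⟨θ, hθ, hv⟩ := h.1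
    exact hv ▸ hall θ hθ

/-- The single band case of the theorem. -/
theorem worstGain_lt_iff_exists {N : ℕ} (α : Fin (N + 1) → ℝ) (hα : α 0 = 0) {ω Ω γ : ℝ}
    (hΩ : 0 < Ω) (hband : Set.Icc (ω - Ω) (ω + Ω) ⊆ Set.Icc 0 Real.pi) (hγ : 0 < γ) :
    worstGain α (Set.Icc (ω - Ω) (ω + Ω)) < γ ↔
      ∃ X Y : Matrix (Fin N) (Fin N) ℝ, X.IsSymm ∧ Y.IsSymm ∧ Y.PosDef ∧
        NegDef (lmi α X Y ω Ω γ) := by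
  have hle : ω - Ω ≤ ω + Ω := by linarith
  have h0 : Ω ≤ ω := by linarith [(hband ⟨le_rfl, hle⟩).1]
  have hπ : ω + Ω ≤ Real.pi := (hband ⟨hle, le_rfl⟩).2
  rw [worstGain_lt_iff α hle]
  simp only [gain_lt_iff α hα hγ]
  constructor
  · intro h
    obtain ⟨X, Y, hX, hY, hY0, hpos⟩ := exists_bandForm_lt hΩ h0 hπ (isSymm_gramGap α γ) h
    exact ⟨X, Y, hX, hY, hY0, (negDef_lmi_iff α hX hY ω Ω γ).2 hpos⟩
  · rintro ⟨X, Y, hX, hY, hY0, hneg⟩ θ hθ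
    have hg : geom N θ ≠ 0 := fun h => by simpa [geom] using congrFun h 0
    have h1 := (negDef_lmi_iff α hX hY ω Ω γ).1 hneg _ hg
    have h2 := bandForm_geom_re_nonneg (N := N) (X := X) hY0.posSemidef
      (by linarith : Ω ≤ Real.pi) hθ
    rw [Complex.sub_re] at h1
    linarith

end BandLMI


theorem theorem3 (N L : ℕ) (α : Fin (N + 1) → ℝ) (hα : α 0 = 0)
    (ω Ω γ : Fin L → ℝ)
    (hω : ∀ l, ω l ∈ Set.Ioo 0 Real.pi)
    (hΩ : ∀ l, 0 < Ω l)
    (hband : ∀ l, Set.Icc (ω l - Ω l) (ω l + Ω l) ⊆ Set.Icc 0 Real.pi)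
    (hγ : ∀ l, 0 < γ l) :
    (∀ l, MultiBand.worstGain α (Set.Icc (ω l - Ω l) (ω l + Ω l)) < γ l) ↔
      ∃ X Y : Fin L → Matrix (Fin N) (Fin N) ℝ,
        ∀ l, (X l).IsSymm ∧ (Y l).IsSymm ∧ (Y l).PosDef ∧
          MultiBand.NegDef (MultiBand.lmi α (X l) (Y l) (ω l) (Ω l) (γ l)) := by
  have key := fun l => BandLMI.worstGain_lt_iff_exists α hα (hΩ l) (hband l) (hγ l)
  constructor
  · intro h
    choose X Y hXY using fun l => (key l).1 (h l)
    exact ⟨X, Y, hXY⟩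
  · rintro ⟨X, Y, hXY⟩ l
    exact (key l).2 ⟨X l, Y l, hXY l⟩
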